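/- Let $\mathbb S^1=\mathbb R/2\pi\mathbb Z$ with arc-length distance $d_G$ and arc-length measure $d\theta$. For $\mu\in\mathbb S^1$ and $\gamma>0$ let $gN(\mu,\gamma)$ be the probability law on $\mathbb S^1$ with density $f(\theta;\mu,\gamma)=k(\gamma)^{-1}e^{-\frac{\gamma}{2}d_G(\mu,\theta)^2}$, where $$k(\gamma)=\int_{-\pi}^{\pi}e^{-\frac{\gamma}{2}t^2}\,dt=\sqrt{\tfrac{2\pi}{\gamma}}\;\mathrm{erf}\!\left(\pi\sqrt{\tfrac{\gamma}{2}}\right),\qquad V(\gamma)=\frac1\gamma\Bigl(1-2\pi k(\gamma)^{-1}e^{-\gamma\pi^2/2}\Bigr).$$ For a sample $x_1,\dots,x_n\in\mathbb S^1$, the intrinsic sample mean set $\widehat\mu^I$ is the set of minimizers over $\mathbb S^1$ of $\mu\mapsto\frac1n\sum_i d_G(\mu,x_i)^2$, and the intrinsic sample variance $\widehat\sigma_I^2$ is the minimum value. The MLE set is the set of maximizers of $\ell(\mu,\gamma)=\sum_i\log f(x_i;\mu,\gamma)$ over $(\mu,\gamma)\in\mathbb S^1\times(0,\infty)$. Let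 $\mu^\star\in\mathbb S^1$, $\gamma^\star>0$, and let $\theta_1,\theta_2,\dots$ be i.i.d. with law $gN(\mu^\star,\gamma^\star)$. (i) $V$ is strictly decreasing on $(0,\infty)$. For every sample $x_1,\dots,x_n$ whose points are not all equal, $\widehat\mu^I$ is non-empty, $\widehat\sigma_I^2$ lies in $V((0,\infty))$, and the MLE set is $\widehat\mu^I\times\{V^{-1}(\widehat\sigma_I^2)\}$; that is, the MLE of $\mu^\star$ is the intrinsic sample mean set and the MLE of $\gamma^\star$ is the unique value $V^{-1}(\widehat\sigma_I^2)$. Almost surely, for all $n\ge2$, the points $\theta_1,\dots,\theta_n$ are not all equal, and the MLE set is unchanged if the antipode of $\mu^\star$ is removed from the range of $\mu$. (ii) The MLE is strongly consistent: almost surely, for every neighbourhood $U$ of $(\mu^\star,\gamma^\star)$, the MLE set of $\theta_1,\dots,\theta_n$ is non-empty and contained in $U$ for all sufficiently large $n$. (iii) Let $(\widehat\mu_n,\widehat\gamma_n)$ be random variables that, for each $n\ge2$, almost surely belong to the MLE set of $\theta_1,\dots,\theta_n$. With $\widehat\mu_n-\mu^\star$ unwrapped to $(-\pi,\pi]$,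 $$\sqrt n\,\bigl(\widehat\mu_n-\mu^\star,\ \widehat\gamma_n-\gamma^\star\bigr)^T\xrightarrow{d}\mathcal N\bigl(0,J(\gamma^\star)^{-1}\bigr),$$ where $J(\gamma^\star)=\mathrm{diag}(J_1(\gamma^\star),J_2(\gamma^\star))$ is positive definite and is the Fisher information matrix of the model at $(\mu^\star,\gamma^\star)$ (the second-moment matrix of the score), with $$J_1(\gamma^\star)=\gamma^\star\Bigl(1-2\pi k(\gamma^\star)^{-1}e^{-\frac{\gamma^\star}{2}\pi^2}\Bigr),\qquad J_2(\gamma^\star)=\frac{k''(\gamma^\star)}{k(\gamma^\star)}-\Bigl(\frac{k'(\gamma^\star)}{k(\gamma^\star)}\Bigr)^2.$$ -/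

import Mathlib

open Real Set Filter Topology MeasureTheory ProbabilityTheory

noncomputable section

namespace GeodesicNormal

instance factTwoPiPos : Fact (0 < 2 * π) := ⟨Real.two_pi_pos⟩

/-- The circle `ℝ / 2πℤ`. Mathlib's distance on it, `dist x y = ‖x - y‖`, is the arc length
(geodesic) distance, and its `volume` is the arc length measure `dθ`, of total mass `2π`. -/
abbrev S1 : Type := AddCircle (2 * π)

/-- The representative in `(-π, π]` of a point of the circle. -/
def unwrap (x : S1) : ℝ := (AddCircle.equivIoc (2 * π) (-π) x : ℝ)

/-- The error function. -/
def erf (x : ℝ) : ℝ := 2 / √π * ∫ t in (0 : ℝ)..x, exp (-t ^ 2)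

/-- The normalizing constant `k(γ)`, the total mass of `θ ↦ exp (-(γ / 2) d_G(μ, θ)²)`. -/
def k (γ : ℝ) : ℝ := ∫ t in (-π)..π, exp (-(γ / 2) * t ^ 2)

/-- The closed form of the normalizing constant. -/
theorem k_eq_erf {γ : ℝ} (hγ : 0 < γ) : k γ = √(2 * π / γ) * erf (π * √(γ / 2)) := by
  have hc : 0 < √(γ / 2) := Real.sqrt_pos.2 (by positivity)
  have hsq : √(γ / 2) ^ 2 = γ / 2 := Real.sq_sqrt (by positivity)
  set c := √(γ / 2) with hcdef
  have h1 : (∫ t in (0 : ℝ)..π, exp (-(γ / 2) * t ^ 2))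
      = c⁻¹ * ∫ t in (0 : ℝ)..(π * c), exp (-t ^ 2) := by
    have h := intervalIntegral.integral_comp_mul_right (a := (0 : ℝ)) (b := π)
      (fun t : ℝ => exp (-t ^ 2)) hc.ne'
    simp only [zero_mul, smul_eq_mul] at h
    rw [← h]
    refine intervalIntegral.integral_congr fun t _ => ?_
    simp only [mul_pow, hsq]
    congr 1
    ring
  have h2 : (∫ t in (-π)..(0 : ℝ), exp (-(γ / 2) * t ^ 2))
      = ∫ t in (0 : ℝ)..π, exp (-(γ / 2) * t ^ 2) := by
    have h := intervalIntegral.integral_comp_neg (a := (0 : ℝ)) (b := π)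
      (fun t : ℝ => exp (-(γ / 2) * t ^ 2))
    simp only [neg_zero, neg_sq] at h
    exact h.symm
  have hint : ∀ a b : ℝ,
      IntervalIntegrable (fun t : ℝ => exp (-(γ / 2) * t ^ 2)) volume a b := fun a b =>
    Continuous.intervalIntegrable (by fun_prop) a b
  have h3 : √(2 * π / γ) = √π * c⁻¹ := by
    rw [hcdef, ← Real.sqrt_inv, ← Real.sqrt_mul pi_pos.le]
    congr 1
    field_simp
  have hπ : √π ≠ 0 := (Real.sqrt_pos.2 pi_pos).ne'
  rw [k, ← intervalIntegral.integral_add_adjacent_intervals (hint _ 0) (hint 0 _), h2, h1, h3, erf]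
  field_simp
  ring

/-- The density of the geodesic Normal distribution with respect to arc length. -/
def gNPDF (μ : S1) (γ : ℝ) (θ : S1) : ℝ := (k γ)⁻¹ * exp (-(γ / 2) * dist μ θ ^ 2)

/-- The geodesic Normal distribution `gN(μ, γ)` on the circle. -/
def gN (μ : S1) (γ : ℝ) : Measure S1 := volume.withDensity fun θ => ENNReal.ofReal (gNPDF μ γ θ)

theorem k_pos (γ : ℝ) : 0 < k γ :=
  intervalIntegral.intervalIntegral_pos_of_pos
    (Continuous.intervalIntegrable (by fun_prop) _ _) (fun _ => exp_pos _) (by linarith [pi_pos])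

instance gN_isProbabilityMeasure (μ : S1) (γ : ℝ) : IsProbabilityMeasure (gN μ γ) := by
  have hcont : Continuous (gNPDF μ γ) := by unfold gNPDF; fun_prop
  have hnn : ∀ θ, 0 ≤ gNPDF μ γ θ := fun θ => by
    have := k_pos γ
    unfold gNPDF
    positivity
  have hint : Integrable (gNPDF μ γ) (volume : Measure S1) :=
    hcont.integrable_of_hasCompactSupport (HasCompactSupport.of_compactSpace _)
  have h1 : ∫ θ, gNPDF μ γ θ = 1 := by
    have e1 : ∫ θ, gNPDF μ γ θ = ∫ θ, gNPDF μ γ (θ + μ) := (integral_add_right_eq_self _ μ).symm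
    have e2 : (∫ θ : S1, gNPDF μ γ (θ + μ))
        = ∫ t in (-π)..(-π + 2 * π), gNPDF μ γ ((t : S1) + μ) :=
      (AddCircle.intervalIntegral_preimage (2 * π) (-π) fun θ : S1 => gNPDF μ γ (θ + μ)).symm
    have e3 : -π + 2 * π = π := by ring
    have e4 : (∫ t in (-π)..π, gNPDF μ γ ((t : S1) + μ))
        = ∫ t in (-π)..π, (k γ)⁻¹ * exp (-(γ / 2) * t ^ 2) := by
      refine intervalIntegral.integral_congr fun t ht => ?_
      rw [uIcc_of_le (by linarith [pi_pos])] at ht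
      have hd : dist μ ((t : S1) + μ) = |t| := by
        rw [dist_comm, dist_eq_norm, add_sub_cancel_right]
        refine (AddCircle.norm_coe_eq_abs_iff (2 * π) two_pi_pos.ne').2 ?_
        rw [abs_of_pos two_pi_pos]
        refine abs_le.2 ⟨?_, ?_⟩ <;> linarith [ht.1, ht.2]
      simp only [gNPDF, hd, sq_abs]
    rw [e1, e2, e3, e4, intervalIntegral.integral_const_mul]
    exact inv_mul_cancel₀ (k_pos γ).ne'
  refine ⟨?_⟩
  rw [gN, withDensity_apply _ MeasurableSet.univ, Measure.restrict_univ,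
    ← ofReal_integral_eq_lintegral_ofReal hint (Eventually.of_forall hnn), h1, ENNReal.ofReal_one]

/-- The intrinsic variance of `gN(μ, γ)` as a function of `γ > 0`. -/
def V (γ : ℝ) : ℝ := 1 / γ * (1 - 2 * π * (k γ)⁻¹ * exp (-(γ * π ^ 2) / 2))

/-- The inverse of `V : (0, ∞) → ℝ` on its image. -/
def VInv : ℝ → ℝ := Function.invFunOn V (Ioi 0)

/-- The empirical Fréchet function `μ ↦ n⁻¹ ∑ i, d_G(μ, x i)²` of a sample. -/
def frechet {n : ℕ} (x : Fin n → S1) (μ : S1) : ℝ := (n : ℝ)⁻¹ * ∑ i, dist μ (x i) ^ 2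

/-- The intrinsic sample mean set. -/
def sampleMeanSet {n : ℕ} (x : Fin n → S1) : Set S1 := {μ | ∀ ν, frechet x μ ≤ frechet x ν}

/-- The intrinsic sample variance: the minimum of the empirical Fréchet function. -/
def sampleVar {n : ℕ} (x : Fin n → S1) : ℝ := ⨅ μ, frechet x μ

/-- The intrinsic sample variance is the value of the Fréchet function at any sample mean. -/
theorem frechet_eq_sampleVar {n : ℕ} (x : Fin n → S1) {μ : S1} (hμ : μ ∈ sampleMeanSet x) :
    frechet x μ = sampleVar x :=
  le_antisymm (le_ciInf hμ) (ciInf_le ⟨frechet x μ, forall_mem_range.2 hμ⟩ μ)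

/-- The log-likelihood of an i.i.d. sample from `gN(μ, γ)`. -/
def logLik {n : ℕ} (x : Fin n → S1) (μ : S1) (γ : ℝ) : ℝ := ∑ i, log (gNPDF μ γ (x i))

/-- The set of maximum likelihood estimates of `(μ, γ)` over a parameter set `Θ`. -/
def mleSet (Θ : Set (S1 × ℝ)) {n : ℕ} (x : Fin n → S1) : Set (S1 × ℝ) :=
  {p ∈ Θ | ∀ q ∈ Θ, logLik x q.1 q.2 ≤ logLik x p.1 p.2}

/-- The full parameter set: `μ` anywhere on the circle, `γ > 0`. -/
def fullParam : Set (S1 × ℝ) := {p | 0 < p.2}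

/-- The parameter set in which the antipode of the true location `μs` is left out. -/
def cutParam (μs : S1) : Set (S1 × ℝ) := {p | p.1 ≠ μs + ((π : ℝ) : S1) ∧ 0 < p.2}

/-- The score: the derivatives of `log f(θ; μ, γ)` in `μ` (in the angular coordinate) and in `γ`. -/
def score (μ : S1) (γ : ℝ) (θ : S1) : Fin 2 → ℝ :=
  ![deriv (fun t : ℝ => log (gNPDF (μ + (t : S1)) γ θ)) 0, deriv (fun g => log (gNPDF μ g θ)) γ]

/-- The Fisher information matrix of the model `gN(μ, γ)`: second moments of the score. -/
def fisherInfo (μ : S1) (γ : ℝ) : Matrix (Fin 2) (Fin 2) ℝ :=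
  Matrix.of fun a b => ∫ θ, score μ γ θ a * score μ γ θ b ∂(gN μ γ)

def J1 (γ : ℝ) : ℝ := γ * (1 - 2 * π * (k γ)⁻¹ * exp (-(γ / 2) * π ^ 2))

def J2 (γ : ℝ) : ℝ := deriv (deriv k) γ / k γ - (deriv k γ / k γ) ^ 2

/-- The matrix `diag(J₁(γ), J₂(γ))`. -/
def J (γ : ℝ) : Matrix (Fin 2) (Fin 2) ℝ := Matrix.diagonal ![J1 γ, J2 γ]

end GeodesicNormal

end

open GeodesicNormal

noncomputable section

namespace GeodesicNormal

/-! ### Geometry of the circle -/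

/-! The log-likelihood equals `-n (log k(γ) + (γ/2) F_n(μ))`, with `F_n` the empirical Fréchet
function. For every `γ > 0` it is therefore maximal in `μ` exactly on the sample mean set. What
remains is `log k(γ) + γ s / 2`, with `s` the sample variance and derivative `(s - V(γ))/2`: `V` is
the second moment of the Normal law truncated to `(-π, π]`, that is `-2 (log k)'`. Moreover `V' = -2
J2 < 0`, since `4 J2` is the variance of the squared truncated variable, so the maximizer is unique.
It exists because `V` takes every value in `(0, π²/3)` and `0 < s < π²/3` (`sampleVar_lt`).

The central fact about a sample mean `μ` is its first-order condition: any real lifts of `μ - x i`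
of minimal modulus sum to zero (`sum_lift_eq_zero`). Hence no sample point is antipodal to `μ`, and
a fixed point of the circle is almost surely never a sample mean.

Consistency: the functions `F_n` are `2π`-Lipschitz and converge uniformly, and their limit has `μs`
as unique minimizer (`popFrechet_lt`).

Normality: put `a = unwrap (μ̂ - μs)` and `Y i = unwrap (θ i - μs)`. For `a ≥ 0` the first-order
condition reads `n a - ∑ Y i - 2π #{i : π + Y i ≤ a} = 0`, where the count records the terms that
wrap around; `a < 0` is the mirror image. With `f(π)` the density at the antipode, the count divided
by `n` is `f(π) a + o(a + n^(-1/2))`, uniformly for small `a` and with high probability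
(`exists_tendsto_meas_count`). So `(1 - 2π f(π)) √n a ≈ n^(-1/2) ∑ Y i`, and `1 - 2π f(π) = γ V(γ)`.
The sample variance differs from the mean of the `Y i ^ 2` by at most `a²`, which is negligible, and
linearizing `V` at `γs` yields `√n (γ̂ - γs)`. The central limit theorem for `(Y, Y²)` and Slutsky's
lemma finish the proof. -/

theorem unwrap_mem (x : S1) : unwrap x ∈ Ioc (-π) π := by
  have h := (AddCircle.equivIoc (2 * π) (-π) x).2
  exact ⟨h.1, h.2.trans_eq (by ring)⟩

@[simp] theorem coe_unwrap (x : S1) : ((unwrap x : ℝ) : S1) = x :=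
  AddCircle.coe_equivIoc (p := 2 * π) (a := -π)

theorem unwrap_coe {t : ℝ} (ht : t ∈ Ioc (-π) π) : unwrap (t : S1) = t := by
  rw [show Ioc (-π) π = Ioc (-π) (-π + 2 * π) by congr 1; ring] at ht
  rw [unwrap, AddCircle.equivIoc_coe_eq (p := 2 * π) (a := -π) ht]

theorem measurable_unwrap : Measurable unwrap :=
  measurable_subtype_coe.comp (AddCircle.measurableEquivIoc (2 * π) (-π)).measurable

theorem unwrap_injective : Function.Injective unwrap := fun x y h => by
  rw [← coe_unwrap x, ← coe_unwrap y, h]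

theorem norm_coe_of_abs_le {t : ℝ} (ht : |t| ≤ π) : ‖(t : S1)‖ = |t| := by
  refine (AddCircle.norm_coe_eq_abs_iff (2 * π) two_pi_pos.ne').2 ?_
  rw [abs_of_pos two_pi_pos]
  linarith

theorem abs_unwrap_le (x : S1) : |unwrap x| ≤ π :=
  abs_le.2 ⟨(unwrap_mem x).1.le, (unwrap_mem x).2⟩

theorem abs_unwrap (x : S1) : |unwrap x| = ‖x‖ := by
  rw [← norm_coe_of_abs_le (abs_unwrap_le x), coe_unwrap]

theorem norm_le_pi (x : S1) : ‖x‖ ≤ π := abs_unwrap x ▸ abs_unwrap_le x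

theorem dist_le_pi (x y : S1) : dist x y ≤ π := dist_eq_norm x y ▸ norm_le_pi _

theorem norm_coe_le_abs (t : ℝ) : ‖(t : S1)‖ ≤ |t| := by
  rcases le_total |t| π with h | h
  · exact (norm_coe_of_abs_le h).le
  · exact (norm_le_pi _).trans h

theorem norm_coe_sq_le (t : ℝ) : ‖(t : S1)‖ ^ 2 ≤ t ^ 2 := by
  rw [← sq_abs t]
  gcongr
  exact norm_coe_le_abs t

theorem coe_neg_pi : ((-π : ℝ) : S1) = ((π : ℝ) : S1) := by
  have := AddCircle.coe_add_period (2 * π) (-π)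
  rwa [show -π + 2 * π = π by ring, eq_comm] at this

/-! ### The sample mean set -/

theorem continuous_frechet {n : ℕ} (x : Fin n → S1) : Continuous (frechet x) := by
  unfold frechet
  fun_prop

theorem sampleMeanSet_nonempty {n : ℕ} (x : Fin n → S1) : (sampleMeanSet x).Nonempty := by
  obtain ⟨μ, -, hμ⟩ := isCompact_univ.exists_isMinOn univ_nonempty (continuous_frechet x).continuousOn
  exact ⟨μ, fun ν => hμ (mem_univ ν)⟩

theorem bddBelow_range_frechet {n : ℕ} (x : Fin n → S1) : BddBelow (range (frechet x)) := by
  obtain ⟨μ, hμ⟩ := sampleMeanSet_nonempty x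
  exact ⟨frechet x μ, forall_mem_range.2 hμ⟩

theorem sampleVar_le {n : ℕ} (x : Fin n → S1) (μ : S1) : sampleVar x ≤ frechet x μ :=
  ciInf_le (bddBelow_range_frechet x) μ

/-- Moving along the circle by `t` changes the Fréchet function by at most the change of the
quadratic function obtained by lifting the sample to the line. -/
theorem frechet_add_le {n : ℕ} (hn : 0 < n) (x : Fin n → S1) (μ : S1) (u : Fin n → ℝ)
    (hu : ∀ i, (u i : S1) = μ - x i) (habs : ∀ i, |u i| = dist μ (x i)) (t : ℝ) :
    frechet x (μ + (t : S1)) ≤ frechet x μ + 2 * t * ((n : ℝ)⁻¹ * ∑ i, u i) + t ^ 2 := by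
  have hn' : (n : ℝ) ≠ 0 := by positivity
  have h1 : ∀ i, dist (μ + (t : S1)) (x i) ^ 2 ≤ dist μ (x i) ^ 2 + 2 * t * u i + t ^ 2 := by
    intro i
    have h2 : μ + (t : S1) - x i = ((u i + t : ℝ) : S1) := by
      rw [AddCircle.coe_add, hu]
      abel
    rw [dist_eq_norm, h2, ← habs i, sq_abs]
    refine (norm_coe_sq_le _).trans_eq ?_
    ring
  calc frechet x (μ + (t : S1))
      ≤ (n : ℝ)⁻¹ * ∑ i, (dist μ (x i) ^ 2 + 2 * t * u i + t ^ 2) := by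
        unfold frechet
        gcongr with i
        exact h1 i
    _ = frechet x μ + 2 * t * ((n : ℝ)⁻¹ * ∑ i, u i) + t ^ 2 := by
        simp only [frechet, Finset.sum_add_distrib, ← Finset.mul_sum, Finset.sum_const,
          Finset.card_univ, Fintype.card_fin, nsmul_eq_mul]
        field_simp

/-- The quadratic bound of `frechet_add_le` is attained at `t = 0`; with `m` the mean of the lifts,
moving by `-m` would lower the Fréchet function by at least `m²`. The lifts stay general because an
antipodal point admits both `π` and `-π`. -/
theorem sum_lift_eq_zero {n : ℕ} (hn : 0 < n) {x : Fin n → S1} {μ : S1}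
    (hμ : μ ∈ sampleMeanSet x) (u : Fin n → ℝ) (hu : ∀ i, (u i : S1) = μ - x i)
    (habs : ∀ i, |u i| = dist μ (x i)) : ∑ i, u i = 0 := by
  set m := (n : ℝ)⁻¹ * ∑ i, u i with hm
  have h := (hμ (μ + ((-m : ℝ) : S1))).trans (frechet_add_le hn x μ u hu habs (-m))
  rw [← hm] at h
  have hm0 : m = 0 := by nlinarith
  rw [hm] at hm0
  rcases mul_eq_zero.1 hm0 with h0 | h0
  · exact absurd h0 (by positivity)
  · exact h0

theorem abs_unwrap_sub (x y : S1) : |unwrap (x - y)| = dist x y := by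
  rw [abs_unwrap, dist_eq_norm]

theorem sum_unwrap_eq_zero {n : ℕ} (hn : 0 < n) {x : Fin n → S1} {μ : S1}
    (hμ : μ ∈ sampleMeanSet x) : ∑ i, unwrap (μ - x i) = 0 :=
  sum_lift_eq_zero hn hμ _ (fun _ => coe_unwrap _) fun _ => abs_unwrap_sub _ _

/-- No sample point is antipodal to a sample mean. -/
theorem unwrap_ne_pi_of_mem {n : ℕ} {x : Fin n → S1} {μ : S1}
    (hμ : μ ∈ sampleMeanSet x) (j : Fin n) : unwrap (μ - x j) ≠ π := by
  intro hj
  have hn : 0 < n := j.pos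
  have h0 := sum_unwrap_eq_zero hn hμ
  -- Exchanging the lift `π` of the antipodal point for `-π` gives another admissible family. Both
  -- families sum to zero, yet the sums differ by `2π`.
  have h1 := sum_lift_eq_zero hn hμ (Function.update (fun i => unwrap (μ - x i)) j (-π)) ?_ ?_
  · rw [Finset.sum_update_of_mem (Finset.mem_univ j)] at h1
    rw [← Finset.add_sum_erase _ _ (Finset.mem_univ j), hj, Finset.erase_eq] at h0
    linarith [pi_pos]
  · intro i
    rcases eq_or_ne i j with rfl | hij
    · rw [Function.update_self, coe_neg_pi, ← congrArg ((↑) : ℝ → S1) hj, coe_unwrap]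
    · rw [Function.update_of_ne hij, coe_unwrap]
  · intro i
    rcases eq_or_ne i j with rfl | hij
    · rw [Function.update_self, abs_neg, ← abs_unwrap_sub, hj]
    · rw [Function.update_of_ne hij, abs_unwrap_sub]

theorem integral_S1_eq (f : S1 → ℝ) : ∫ x : S1, f x = ∫ t in (-π)..π, f (t : S1) := by
  have h := AddCircle.intervalIntegral_preimage (2 * π) (-π) f
  rw [show -π + 2 * π = π by ring] at h
  exact h.symm

theorem integral_dist_sq (y : S1) : ∫ μ : S1, dist μ y ^ 2 = 2 * π * (π ^ 2 / 3) := by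
  have e1 : ∫ μ : S1, dist μ y ^ 2 = ∫ μ : S1, ‖μ‖ ^ 2 := by
    simp only [dist_eq_norm]
    exact integral_sub_right_eq_self (fun μ : S1 => ‖μ‖ ^ 2) y
  rw [e1, integral_S1_eq]
  have e2 : ∫ t in (-π)..π, ‖(t : S1)‖ ^ 2 = ∫ t in (-π)..π, t ^ 2 := by
    refine intervalIntegral.integral_congr fun t ht => ?_
    rw [uIcc_of_le (by linarith [pi_pos])] at ht
    simp only [norm_coe_of_abs_le (abs_le.2 ht), sq_abs]
  rw [e2, integral_pow]
  ring

theorem integrable_of_continuous {f : S1 → ℝ} (hf : Continuous f) {ν : Measure S1}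
    [IsFiniteMeasure ν] : Integrable f ν :=
  hf.integrable_of_hasCompactSupport (HasCompactSupport.of_compactSpace _)

/-- The mean of the Fréchet function over the circle is `π²/3`. A minimum that large would force the
function to be constant, so the antipode of a sample point would be a sample mean, contradicting
`unwrap_ne_pi_of_mem`. -/
theorem sampleVar_lt {n : ℕ} (hn : 0 < n) (x : Fin n → S1) : sampleVar x < π ^ 2 / 3 := by
  have hn' : (n : ℝ) ≠ 0 := by positivity
  by_contra! hle
  have hint : ∫ μ : S1, (frechet x μ - sampleVar x) = 2 * π * (π ^ 2 / 3 - sampleVar x) := by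
    rw [integral_sub (integrable_of_continuous (continuous_frechet x)) (integrable_const _)]
    simp only [frechet]
    rw [integral_const_mul, integral_finsetSum]
    · simp only [integral_dist_sq, Finset.sum_const, Finset.card_univ, Fintype.card_fin,
        nsmul_eq_mul, integral_const, Measure.real, AddCircle.measure_univ,
        ENNReal.toReal_ofReal two_pi_pos.le, smul_eq_mul]
      field_simp
    · exact fun i _ => integrable_of_continuous (by fun_prop)
  have hnn : 0 ≤ fun μ => frechet x μ - sampleVar x := fun μ => sub_nonneg.2 (sampleVar_le x μ)
  have hz : ∫ μ : S1, (frechet x μ - sampleVar x) = 0 := by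
    refine le_antisymm ?_ (integral_nonneg hnn)
    rw [hint]
    exact mul_nonpos_of_nonneg_of_nonpos two_pi_pos.le (by linarith)
  have hc : Continuous fun μ => frechet x μ - sampleVar x :=
    (continuous_frechet x).sub continuous_const
  have hae := (integral_eq_zero_iff_of_nonneg hnn (integrable_of_continuous hc)).1 hz
  have heq := (hc.ae_eq_iff_eq volume continuous_const).1 hae
  have hmem : x ⟨0, hn⟩ + ((π : ℝ) : S1) ∈ sampleMeanSet x := fun ν => by
    have h1 := congrFun heq (x ⟨0, hn⟩ + ((π : ℝ) : S1))
    have h2 := congrFun heq ν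
    linarith
  refine unwrap_ne_pi_of_mem hmem ⟨0, hn⟩ ?_
  rw [add_sub_cancel_left, unwrap_coe ⟨by linarith [pi_pos], le_rfl⟩]

theorem sampleVar_pos {n : ℕ} {x : Fin n → S1} (hx : ∃ i j, x i ≠ x j) : 0 < sampleVar x := by
  obtain ⟨i, j, hij⟩ := hx
  obtain ⟨μ, hμ⟩ := sampleMeanSet_nonempty x
  have hn : (0 : ℝ) < n := by exact_mod_cast i.pos
  rw [← frechet_eq_sampleVar x hμ, frechet]
  refine mul_pos (inv_pos.2 hn) ?_
  by_contra! h
  have h0 := le_antisymm h (Finset.sum_nonneg fun i _ => sq_nonneg (dist μ (x i)))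
  rw [Finset.sum_eq_zero_iff_of_nonneg fun i _ => sq_nonneg _] at h0
  have : ∀ i, μ = x i := fun i => dist_eq_zero.1 (pow_eq_zero_iff two_ne_zero |>.1 (h0 i (by simp)))
  exact hij ((this i).symm.trans (this j))

/-! ### Truncated Gaussian moments and the variance function `V` -/

/-- The unnormalized moments of the centred Normal law truncated to `[-π, π]`. -/
def gaussMoment (m : ℕ) (γ : ℝ) : ℝ := ∫ t in (-π)..π, t ^ m * exp (-(γ / 2) * t ^ 2)

theorem gaussMoment_zero : gaussMoment 0 = k := by
  funext γ
  simp [gaussMoment, k]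

theorem intervalIntegrable_gaussMoment (m : ℕ) (γ a b : ℝ) :
    IntervalIntegrable (fun t : ℝ => t ^ m * exp (-(γ / 2) * t ^ 2)) volume a b :=
  Continuous.intervalIntegrable (by fun_prop) _ _

theorem hasDerivAt_gaussMoment (m : ℕ) (γ : ℝ) :
    HasDerivAt (gaussMoment m) (-(1 / 2) * gaussMoment (m + 2) γ) γ := by
  have h := (intervalIntegral.hasDerivAt_integral_of_dominated_loc_of_deriv_le (μ := volume)
    (a := -π) (b := π) (F := fun g t => t ^ m * exp (-(g / 2) * t ^ 2))
    (F' := fun g t => t ^ m * (exp (-(g / 2) * t ^ 2) * (-(1 / 2) * t ^ 2)))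
    (x₀ := γ) (s := Metric.ball γ 1)
    (bound := fun t => |t| ^ m * (exp ((|γ| + 1) / 2 * t ^ 2) * (1 / 2 * t ^ 2)))
    (Metric.ball_mem_nhds γ one_pos) (Eventually.of_forall fun g => ?_)
    (intervalIntegrable_gaussMoment m γ _ _) ?_ ?_ ?_ ?_).2
  · convert! h using 1
    rw [gaussMoment, ← intervalIntegral.integral_const_mul]
    refine intervalIntegral.integral_congr fun t _ => ?_
    ring
  · exact Continuous.aestronglyMeasurable (by fun_prop)
  · exact Continuous.aestronglyMeasurable (by fun_prop)
  · refine Eventually.of_forall fun t _ g hg => ?_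
    have hg' : -g ≤ |γ| + 1 := by
      rw [Metric.mem_ball, Real.dist_eq] at hg
      have h1 := neg_abs_le γ
      have h2 := (abs_lt.1 hg).1
      linarith
    rw [norm_mul, norm_mul, norm_pow, norm_mul, Real.norm_eq_abs, Real.norm_eq_abs, Real.norm_eq_abs,
      Real.norm_eq_abs, abs_neg, abs_of_pos (exp_pos _), abs_of_nonneg (sq_nonneg t),
      abs_of_pos (by norm_num : (0 : ℝ) < 1 / 2)]
    gcongr
    linarith
  · exact Continuous.intervalIntegrable (by fun_prop) _ _
  · refine Eventually.of_forall fun t _ g _ => ?_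
    refine HasDerivAt.const_mul _ (HasDerivAt.exp ?_)
    refine HasDerivAt.mul_const ?_ _
    convert! ((hasDerivAt_id g).div_const 2).neg using 1

theorem continuous_gaussMoment (m : ℕ) : Continuous (gaussMoment m) :=
  continuous_iff_continuousAt.2 fun γ => (hasDerivAt_gaussMoment m γ).continuousAt

theorem hasDerivAt_k (γ : ℝ) : HasDerivAt k (-(1 / 2) * gaussMoment 2 γ) γ := by
  rw [← gaussMoment_zero]
  exact hasDerivAt_gaussMoment 0 γ

theorem deriv_k : deriv k = fun γ => -(1 / 2) * gaussMoment 2 γ :=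
  funext fun γ => (hasDerivAt_k γ).deriv

theorem deriv_deriv_k (γ : ℝ) : deriv (deriv k) γ = 1 / 4 * gaussMoment 4 γ := by
  rw [deriv_k, ((hasDerivAt_gaussMoment 2 γ).const_mul _).deriv]
  ring

/-- The density of `gN(μ, γ)` at the antipode of `μ`. -/
def edgeDensity (γ : ℝ) : ℝ := (k γ)⁻¹ * exp (-(γ / 2) * π ^ 2)

theorem edgeDensity_pos (γ : ℝ) : 0 < edgeDensity γ := mul_pos (inv_pos.2 (k_pos γ)) (exp_pos _)

/-- Integration by parts, from the derivative of `t * exp (-(γ / 2) * t ^ 2)`. The boundary term is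
the source of the antipodal density in `V` and `J1`. -/
theorem mul_gaussMoment_two (γ : ℝ) :
    γ * gaussMoment 2 γ = k γ - 2 * π * exp (-(γ / 2) * π ^ 2) := by
  have h : ∀ t ∈ uIcc (-π) π, HasDerivAt (fun t : ℝ => t * exp (-(γ / 2) * t ^ 2))
      (exp (-(γ / 2) * t ^ 2) - γ * (t ^ 2 * exp (-(γ / 2) * t ^ 2))) t := by
    intro t _
    convert! (hasDerivAt_id t).mul ((((hasDerivAt_id t).pow 2).const_mul (-(γ / 2))).exp) using 1
    simp
    ring
  have h1 := intervalIntegral.integral_eq_sub_of_hasDerivAt h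
    (Continuous.intervalIntegrable (by fun_prop) _ _)
  rw [intervalIntegral.integral_sub (Continuous.intervalIntegrable (by fun_prop) _ _)
    (Continuous.intervalIntegrable (by fun_prop) _ _), intervalIntegral.integral_const_mul] at h1
  rw [gaussMoment, k]
  rw [neg_sq] at h1
  linarith

theorem V_eq {γ : ℝ} (hγ : 0 < γ) : V γ = gaussMoment 2 γ / k γ := by
  have hk := (k_pos γ).ne'
  have h := mul_gaussMoment_two γ
  rw [V, show -(γ * π ^ 2) / 2 = -(γ / 2) * π ^ 2 by ring, eq_div_iff hk, one_div, mul_assoc,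
    inv_mul_eq_iff_eq_mul₀ hγ.ne', h, sub_mul, mul_right_comm, mul_assoc (2 * π),
    inv_mul_cancel₀ hk]
  ring

theorem mul_V {γ : ℝ} (hγ : 0 < γ) : γ * V γ = 1 - 2 * π * edgeDensity γ := by
  rw [V, edgeDensity, show -(γ * π ^ 2) / 2 = -(γ / 2) * π ^ 2 by ring]
  field_simp

theorem J1_eq {γ : ℝ} (hγ : 0 < γ) : J1 γ = γ ^ 2 * V γ := by
  rw [pow_two, mul_assoc, mul_V hγ, J1, edgeDensity, mul_assoc (2 * π)]

theorem gaussMoment_two_pos (γ : ℝ) : 0 < gaussMoment 2 γ :=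
  intervalIntegral.integral_pos (by linarith [pi_pos]) (by fun_prop)
    (fun t _ => by positivity) ⟨π, ⟨by linarith [pi_pos], le_rfl⟩, by positivity⟩

theorem V_pos {γ : ℝ} (hγ : 0 < γ) : 0 < V γ := by
  rw [V_eq hγ]
  exact div_pos (gaussMoment_two_pos γ) (k_pos γ)

theorem J1_pos {γ : ℝ} (hγ : 0 < γ) : 0 < J1 γ := by
  rw [J1_eq hγ]
  have := V_pos hγ
  positivity

theorem J2_eq (γ : ℝ) :
    J2 γ = 1 / 4 * (gaussMoment 4 γ / k γ - (gaussMoment 2 γ / k γ) ^ 2) := by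
  rw [J2, deriv_deriv_k, deriv_k]
  ring

/-- `4 * J2 γ` is the variance of `Y²` for `Y` truncated Normal, and `Y²` is not constant: the
integrand `(t ^ 2 - v) ^ 2` is positive at `t = 0`. -/
theorem J2_pos (γ : ℝ) : 0 < J2 γ := by
  have hk := k_pos γ
  set v := gaussMoment 2 γ / k γ with hv
  have hv0 : 0 < v := div_pos (gaussMoment_two_pos γ) hk
  have h1 : 0 < ∫ t in (-π)..π, (t ^ 2 - v) ^ 2 * exp (-(γ / 2) * t ^ 2) :=
    intervalIntegral.integral_pos (by linarith [pi_pos]) (by fun_prop)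
      (fun t _ => by positivity) ⟨0, ⟨by linarith [pi_pos], pi_pos.le⟩, by simp; positivity⟩
  have h2 : ∫ t in (-π)..π, (t ^ 2 - v) ^ 2 * exp (-(γ / 2) * t ^ 2)
      = gaussMoment 4 γ - 2 * v * gaussMoment 2 γ + v ^ 2 * gaussMoment 0 γ := by
    unfold gaussMoment
    rw [← intervalIntegral.integral_const_mul, ← intervalIntegral.integral_const_mul,
      ← intervalIntegral.integral_sub, ← intervalIntegral.integral_add]
    · refine intervalIntegral.integral_congr fun t _ => ?_
      ring
    all_goals exact Continuous.intervalIntegrable (by fun_prop) _ _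
  rw [h2, gaussMoment_zero] at h1
  have h3 : gaussMoment 2 γ = v * k γ := by rw [hv]; field_simp
  have h4 : gaussMoment 4 γ - 2 * v * gaussMoment 2 γ + v ^ 2 * k γ
      = k γ * (4 * J2 γ) := by
    rw [J2_eq, ← hv, h3]
    field_simp
    ring
  rw [h4] at h1
  have := (mul_pos_iff_of_pos_left hk).1 h1
  linarith

theorem hasDerivAt_V {γ : ℝ} (hγ : 0 < γ) : HasDerivAt V (-2 * J2 γ) γ := by
  have hk := (k_pos γ).ne'
  have h := (hasDerivAt_gaussMoment 2 γ).div (hasDerivAt_k γ) hk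
  have h' : HasDerivAt (fun γ => gaussMoment 2 γ / k γ) (-2 * J2 γ) γ := by
    convert! h using 1
    rw [J2_eq]
    field_simp
    ring
  refine h'.congr_of_eventuallyEq ?_
  filter_upwards [Ioi_mem_nhds hγ] with g hg using V_eq hg

theorem strictAntiOn_V : StrictAntiOn V (Ioi 0) := by
  refine strictAntiOn_of_deriv_neg (convex_Ioi 0)
    (fun γ hγ => (hasDerivAt_V hγ).continuousAt.continuousWithinAt) fun γ hγ => ?_
  rw [interior_Ioi] at hγ
  rw [(hasDerivAt_V hγ).deriv]
  linarith [J2_pos γ]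

theorem V_le_inv {γ : ℝ} (hγ : 0 < γ) : V γ ≤ γ⁻¹ := by
  have h := mul_V hγ
  have h1 := edgeDensity_pos γ
  rw [← one_div, le_div_iff₀ hγ, mul_comm, h]
  nlinarith [pi_pos]

/-- The moment ratio extends `V` continuously to `γ = 0`, where the uniform law gives `π²/3`. At `γ
= 2 / s` the bound `V γ ≤ γ⁻¹` gives at most `s / 2`, and the intermediate value theorem applies
between the two. -/
theorem mem_image_V {s : ℝ} (hs : 0 < s) (hs' : s < π ^ 2 / 3) : s ∈ V '' Ioi 0 := by
  have hc : Continuous fun γ => gaussMoment 2 γ / k γ :=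
    (continuous_gaussMoment 2).div (gaussMoment_zero ▸ continuous_gaussMoment 0)
      fun γ => (k_pos γ).ne'
  have h0 : gaussMoment 2 0 / k 0 = π ^ 2 / 3 := by
    have : π ≠ 0 := pi_pos.ne'
    simp only [gaussMoment, k, zero_div, neg_zero, zero_mul, Real.exp_zero, mul_one, integral_pow,
      intervalIntegral.integral_const, smul_eq_mul]
    field_simp
    ring
  have hp : 0 < 2 / s := by positivity
  have h1 : gaussMoment 2 (2 / s) / k (2 / s) < s := by
    rw [← V_eq hp]
    refine (V_le_inv hp).trans_lt ?_
    rw [inv_div]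
    linarith
  obtain ⟨γ, hγ, hγs⟩ := intermediate_value_Icc' hp.le hc.continuousOn ⟨h1.le, h0 ▸ hs'.le⟩
  simp only at hγs
  have hγ0 : 0 < γ := by
    refine hγ.1.lt_of_ne fun h => ?_
    rw [← h, h0] at hγs
    linarith
  exact ⟨γ, hγ0, by rw [V_eq hγ0, hγs]⟩

theorem VInv_pos {s : ℝ} (hs : s ∈ V '' Ioi 0) : 0 < VInv s := Function.invFunOn_mem hs

theorem V_VInv {s : ℝ} (hs : s ∈ V '' Ioi 0) : V (VInv s) = s := Function.invFunOn_eq hs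

/-! ### Deterministic description of the MLE set -/

theorem logLik_eq {n : ℕ} (hn : 0 < n) (x : Fin n → S1) (μ : S1) (γ : ℝ) :
    logLik x μ γ = -(n : ℝ) * (log (k γ) + γ / 2 * frechet x μ) := by
  have hn' : (n : ℝ) ≠ 0 := by positivity
  have h : ∀ i, log (gNPDF μ γ (x i)) = -log (k γ) - γ / 2 * dist μ (x i) ^ 2 := fun i => by
    rw [gNPDF, Real.log_mul (inv_ne_zero (k_pos γ).ne') (exp_pos _).ne', Real.log_inv, Real.log_exp]
    ring
  simp only [logLik, h, frechet, Finset.sum_sub_distrib, Finset.sum_const, Finset.card_univ,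
    Fintype.card_fin, nsmul_eq_mul, ← Finset.mul_sum]
  field_simp
  ring

/-- The profile likelihood in `γ` is uniquely optimized where `V` equals the sample variance. -/
theorem log_k_add_lt {γ₀ γ : ℝ} (hγ₀ : 0 < γ₀) (hγ : 0 < γ) (hne : γ ≠ γ₀) :
    log (k γ₀) + γ₀ / 2 * V γ₀ < log (k γ) + γ / 2 * V γ₀ := by
  set g : ℝ → ℝ := fun γ => log (k γ) + γ / 2 * V γ₀ with hg
  -- Since `(log k)' = -V / 2`, strict monotonicity of `V` fixes the sign of the derivative on
  -- either side of `γ₀`.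
  have hd : ∀ γ, 0 < γ → HasDerivAt g ((V γ₀ - V γ) / 2) γ := fun γ hγ => by
    have h1 := ((hasDerivAt_k γ).log (k_pos γ).ne').add
      (((hasDerivAt_id γ).div_const 2).mul_const (V γ₀))
    convert! h1 using 1
    rw [V_eq hγ]
    ring
  have hcont : ∀ s ⊆ Ioi (0 : ℝ), ContinuousOn g s := fun s hs γ hγ =>
    (hd γ (hs hγ)).continuousAt.continuousWithinAt
  rcases hne.lt_or_gt with h | h
  · have hanti : StrictAntiOn g (Icc γ γ₀) := by
      refine strictAntiOn_of_deriv_neg (convex_Icc _ _)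
        (hcont _ fun x hx => hγ.trans_le hx.1) fun x hx => ?_
      rw [interior_Icc] at hx
      have hx0 : 0 < x := hγ.trans hx.1
      rw [(hd x hx0).deriv]
      linarith [strictAntiOn_V hx0 hγ₀ hx.2]
    exact hanti (left_mem_Icc.2 h.le) (right_mem_Icc.2 h.le) h
  · have hmono : StrictMonoOn g (Icc γ₀ γ) := by
      refine strictMonoOn_of_deriv_pos (convex_Icc _ _)
        (hcont _ fun x hx => hγ₀.trans_le hx.1) fun x hx => ?_
      rw [interior_Icc] at hx
      have hx0 : 0 < x := hγ₀.trans hx.1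
      rw [(hd x hx0).deriv]
      linarith [strictAntiOn_V hγ₀ hx0 hx.1]
    exact hmono (left_mem_Icc.2 h.le) (right_mem_Icc.2 h.le) h

theorem sampleVar_mem_image_V {n : ℕ} {x : Fin n → S1} (hx : ∃ i j, x i ≠ x j) :
    sampleVar x ∈ V '' Ioi 0 :=
  mem_image_V (sampleVar_pos hx) (sampleVar_lt (Exists.elim hx fun i _ => i.pos) x)

/-- The MLE set over any parameter set of the form `A × (0, ∞)` that meets the sample mean set. -/
theorem mleSet_eq_of_inter_nonempty {n : ℕ} {x : Fin n → S1} (hx : ∃ i j, x i ≠ x j)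
    {A : Set S1} (hA : (sampleMeanSet x ∩ A).Nonempty) :
    mleSet {p | p.1 ∈ A ∧ 0 < p.2} x = (sampleMeanSet x ∩ A) ×ˢ {VInv (sampleVar x)} := by
  have hn : 0 < n := Exists.elim hx fun i _ => i.pos
  have hn' : (0 : ℝ) < n := by exact_mod_cast hn
  have hs := sampleVar_mem_image_V hx
  set s := sampleVar x with hsdef
  obtain ⟨m, hm, hmA⟩ := hA
  have hm' : frechet x m = s := frechet_eq_sampleVar x hm
  have key : ∀ γ, 0 < γ → γ ≠ VInv s → log (k (VInv s)) + VInv s / 2 * s < log (k γ) + γ / 2 * s := by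
    intro γ hγ hne
    have h := log_k_add_lt (VInv_pos hs) hγ hne
    rwa [V_VInv hs] at h
  have key' : ∀ γ, 0 < γ → log (k (VInv s)) + VInv s / 2 * s ≤ log (k γ) + γ / 2 * s := by
    intro γ hγ
    rcases eq_or_ne γ (VInv s) with rfl | hne
    · exact le_rfl
    · exact (key γ hγ hne).le
  have hle : ∀ p q : S1 × ℝ, logLik x q.1 q.2 ≤ logLik x p.1 p.2 ↔
      log (k p.2) + p.2 / 2 * frechet x p.1 ≤ log (k q.2) + q.2 / 2 * frechet x q.1 := by
    intro p q
    rw [logLik_eq hn, logLik_eq hn, neg_mul, neg_mul, neg_le_neg_iff, mul_le_mul_iff_right₀ hn']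
  ext ⟨μ, γ⟩
  simp only [mleSet, mem_ofPred_eq, mem_prod, mem_singleton_iff, mem_inter_iff, hle]
  constructor
  · rintro ⟨⟨hμA, hγ⟩, h⟩
    -- Comparison with a sample mean at the same `γ` settles `μ`; comparison at `VInv s` then
    -- settles `γ`.
    have h1 : frechet x μ ≤ s := by
      have h2 := h (m, γ) ⟨hmA, hγ⟩
      simp only [hm'] at h2
      have h3 : γ / 2 * frechet x μ ≤ γ / 2 * s := by linarith
      exact (mul_le_mul_iff_right₀ (by positivity)).1 h3
    have h2 : frechet x μ = s := le_antisymm h1 (sampleVar_le x μ)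
    refine ⟨⟨fun ν => h1.trans (sampleVar_le x ν), hμA⟩, ?_⟩
    by_contra hne
    have h3 := h (m, VInv s) ⟨hmA, VInv_pos hs⟩
    simp only [hm', h2] at h3
    exact absurd (key γ hγ hne) h3.not_gt
  · rintro ⟨⟨hμ, hμA⟩, rfl⟩
    refine ⟨⟨hμA, VInv_pos hs⟩, fun q hq => ?_⟩
    rw [frechet_eq_sampleVar x hμ]
    refine (key' q.2 hq.2).trans ?_
    have := hq.2
    gcongr
    exact sampleVar_le x q.1

theorem mleSet_fullParam {n : ℕ} {x : Fin n → S1} (hx : ∃ i j, x i ≠ x j) :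
    mleSet fullParam x = sampleMeanSet x ×ˢ {VInv (sampleVar x)} := by
  have h := mleSet_eq_of_inter_nonempty hx (A := univ) (by simpa using sampleMeanSet_nonempty x)
  simpa [fullParam] using h

theorem mleSet_cutParam {n : ℕ} {x : Fin n → S1} (hx : ∃ i j, x i ≠ x j) {μs : S1}
    (hμs : μs + ((π : ℝ) : S1) ∉ sampleMeanSet x) :
    mleSet (cutParam μs) x = mleSet fullParam x := by
  have hsub : sampleMeanSet x ∩ {μs + ((π : ℝ) : S1)}ᶜ = sampleMeanSet x :=
    inter_eq_left.2 fun μ hμ h => hμs (mem_singleton_iff.1 h ▸ hμ)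
  have h := mleSet_eq_of_inter_nonempty hx (A := {μs + ((π : ℝ) : S1)}ᶜ)
    (hsub.symm ▸ sampleMeanSet_nonempty x)
  rw [hsub] at h
  rw [mleSet_fullParam hx, ← h]
  rfl

/-! ### The law of the unwrapped observations -/

/-- The density of the centred Normal law truncated to `(-π, π]`. -/
def truncPDF (γ t : ℝ) : ℝ := (k γ)⁻¹ * exp (-(γ / 2) * t ^ 2)

/-- The centred Normal law truncated to `(-π, π]`. -/
def truncGauss (γ : ℝ) : Measure ℝ :=
  (volume.restrict (Ioc (-π) π)).withDensity fun t => ENNReal.ofReal (truncPDF γ t)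

@[fun_prop]
theorem continuous_truncPDF (γ : ℝ) : Continuous (truncPDF γ) := by
  unfold truncPDF
  fun_prop

@[fun_prop]
theorem continuous_gNPDF (μ : S1) (γ : ℝ) : Continuous (gNPDF μ γ) := by
  unfold gNPDF
  fun_prop

theorem truncPDF_nonneg (γ t : ℝ) : 0 ≤ truncPDF γ t := by
  have := k_pos γ
  unfold truncPDF
  positivity

theorem gNPDF_coe_add (μ : S1) (γ : ℝ) {t : ℝ} (ht : t ∈ Ioc (-π) π) :
    gNPDF μ γ ((t : S1) + μ) = truncPDF γ t := by
  have hd : dist μ ((t : S1) + μ) = |t| := by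
    rw [dist_comm, dist_eq_norm, add_sub_cancel_right, norm_coe_of_abs_le (abs_le.2 ⟨ht.1.le, ht.2⟩)]
  rw [gNPDF, truncPDF, hd, sq_abs]

theorem hasLaw_unwrap_sub (μ : S1) (γ : ℝ) :
    HasLaw (fun x => unwrap (x - μ)) (truncGauss γ) (gN μ γ) := by
  have hm : Measurable fun x : S1 => unwrap (x - μ) := measurable_unwrap.comp (by fun_prop)
  refine ⟨hm.aemeasurable, Measure.ext_of_lintegral _ fun f hf => ?_⟩
  have h1 := lintegral_withDensity_eq_lintegral_mul (volume : Measure S1)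
    (f := fun x => ENNReal.ofReal (gNPDF μ γ x)) (by fun_prop) (hf.comp hm)
  have h2 := lintegral_withDensity_eq_lintegral_mul (volume.restrict (Ioc (-π) π))
    (f := fun x => ENNReal.ofReal (truncPDF γ x)) (by fun_prop) hf
  rw [lintegral_map hf hm, gN, truncGauss, h2]
  refine h1.trans ?_
  rw [← lintegral_add_right_eq_self _ μ, ← AddCircle.lintegral_preimage (2 * π) (-π),
    show -π + 2 * π = π by ring]
  refine setLIntegral_congr_fun measurableSet_Ioc fun t ht => ?_
  simp only [Pi.mul_apply, Function.comp, add_sub_cancel_right, unwrap_coe ht, gNPDF_coe_add μ γ ht]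

instance isProbabilityMeasure_truncGauss (γ : ℝ) : IsProbabilityMeasure (truncGauss γ) :=
  (hasLaw_unwrap_sub 0 γ).isProbabilityMeasure_iff.1 inferInstance

theorem truncGauss_absolutelyContinuous (γ : ℝ) :
    truncGauss γ ≪ volume.restrict (Ioc (-π) π) := withDensity_absolutelyContinuous _ _

instance nullSingletonClass_truncGauss (γ : ℝ) : NullSingletonClass (truncGauss γ) :=
  ⟨fun x => truncGauss_absolutelyContinuous γ (measure_singleton x)⟩

theorem ae_mem_truncGauss (γ : ℝ) : ∀ᵐ t ∂(truncGauss γ), t ∈ Ioc (-π) π :=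
  (truncGauss_absolutelyContinuous γ).ae_le (ae_restrict_mem measurableSet_Ioc)

theorem integral_truncGauss (γ : ℝ) (g : ℝ → ℝ) :
    ∫ t, g t ∂(truncGauss γ) = (k γ)⁻¹ * ∫ t in (-π)..π, g t * exp (-(γ / 2) * t ^ 2) := by
  rw [truncGauss, integral_withDensity_eq_integral_toReal_smul
    (by fun_prop) (Eventually.of_forall fun _ => ENNReal.ofReal_lt_top),
    intervalIntegral.integral_of_le (by linarith [pi_pos]), ← integral_const_mul]
  refine integral_congr_ae (Eventually.of_forall fun t => ?_)
  simp only [ENNReal.toReal_ofReal (truncPDF_nonneg γ t), smul_eq_mul]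
  rw [truncPDF]
  ring

theorem integral_pow_truncGauss (γ : ℝ) (m : ℕ) :
    ∫ t, t ^ m ∂(truncGauss γ) = gaussMoment m γ / k γ := by
  rw [integral_truncGauss, gaussMoment]
  ring

theorem gaussMoment_odd {m : ℕ} (hm : Odd m) (γ : ℝ) : gaussMoment m γ = 0 := by
  have h := intervalIntegral.integral_comp_neg (a := -π) (b := π)
    (fun t : ℝ => t ^ m * exp (-(γ / 2) * t ^ 2))
  simp only [neg_neg, hm.neg_pow, neg_sq, neg_mul, intervalIntegral.integral_neg] at h
  have h' : -gaussMoment m γ = gaussMoment m γ := by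
    simp only [gaussMoment, neg_mul]
    exact h
  linarith

theorem memLp_of_continuous_truncGauss {γ : ℝ} {g : ℝ → ℝ} (hg : Continuous g) (p : ENNReal) :
    MemLp g p (truncGauss γ) := by
  obtain ⟨C, hC⟩ := isCompact_Icc.exists_bound_of_continuousOn (s := Icc (-π) π) hg.continuousOn
  exact MemLp.of_bound hg.aestronglyMeasurable C
    ((ae_mem_truncGauss γ).mono fun t ht => hC t (Ioc_subset_Icc_self ht))

theorem integrable_of_continuous_truncGauss {γ : ℝ} {g : ℝ → ℝ} (hg : Continuous g) :
    Integrable g (truncGauss γ) :=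
  memLp_one_iff_integrable.1 (memLp_of_continuous_truncGauss hg 1)

/-! ### Almost sure properties of the sample -/

/-- By Fubini, the diagonal is null for the product of an atomless law with any other. -/
theorem ae_ne_of_indepFun {Ω E : Type*} [MeasurableSpace Ω] {P : Measure Ω}
    [IsProbabilityMeasure P] [MeasurableSpace E] [MeasurableSingletonClass E] [MeasurableEq E]
    {X Y : Ω → E} (hX : AEMeasurable X P) (hY : AEMeasurable Y P) (hXY : IndepFun X Y P)
    [NullSingletonClass (P.map X)] : ∀ᵐ ω ∂P, X ω ≠ Y ω := by
  have : IsProbabilityMeasure (P.map X) := Measure.isProbabilityMeasure_map hX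
  have : IsProbabilityMeasure (P.map Y) := Measure.isProbabilityMeasure_map hY
  have h := (indepFun_iff_map_prod_eq_prod_map_map hX hY).1 hXY
  have hd : MeasurableSet {p : E × E | p.1 = p.2} := measurableSet_diagonal
  have h0 : ((P.map X).prod (P.map Y)) {p : E × E | p.1 = p.2} = 0 := by
    rw [Measure.prod_apply_symm hd, lintegral_eq_zero_iff (measurable_measure_prodMk_right hd)]
    exact Eventually.of_forall fun y => measure_singleton y
  rw [← h, Measure.map_apply_of_aemeasurable (hX.prodMk hY) hd] at h0
  rw [ae_iff]
  simpa using h0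

section Sample

variable {Ω : Type*} [MeasurableSpace Ω] {P : Measure Ω}
  {μs : S1} {γs : ℝ} {θ : ℕ → Ω → S1}

theorem hasLaw_unwrap_sample (hlaw : ∀ i, HasLaw (θ i) (gN μs γs) P) (i : ℕ) :
    HasLaw (fun ω => unwrap (θ i ω - μs)) (truncGauss γs) P :=
  (hasLaw_unwrap_sub μs γs).fun_comp (hlaw i)

variable [IsProbabilityMeasure P]

instance nullSingletonClass_gN (μ : S1) (γ : ℝ) : NullSingletonClass (gN μ γ) := by
  refine ⟨fun x => ?_⟩
  have h := (hasLaw_unwrap_sub μ γ).measure_eq (p := fun t => t = unwrap (x - μ))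
    (measurableSet_singleton _)
  have h1 : {y : S1 | unwrap (y - μ) = unwrap (x - μ)} = {x} := by
    ext y
    simp [unwrap_injective.eq_iff]
  rw [h1] at h
  rw [h]
  exact measure_singleton _

theorem ae_exists_ne (hlaw : ∀ i, HasLaw (θ i) (gN μs γs) P) (hindep : iIndepFun θ P) :
    ∀ᵐ ω ∂P, ∀ n : ℕ, 2 ≤ n → ∃ i j : Fin n, θ i ω ≠ θ j ω := by
  have : NullSingletonClass (P.map (θ 0)) := by rw [(hlaw 0).map_eq]; infer_instance
  filter_upwards [ae_ne_of_indepFun (hlaw 0).aemeasurable (hlaw 1).aemeasurable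
    (hindep.indepFun zero_ne_one)] with ω hω n hn
  exact ⟨⟨0, by omega⟩, ⟨1, by omega⟩, hω⟩

/-- A fixed point of the circle is almost surely not a sample mean. -/
theorem ae_notMem_sampleMeanSet (hlaw : ∀ i, HasLaw (θ i) (gN μs γs) P) (hindep : iIndepFun θ P)
    (a : S1) : ∀ᵐ ω ∂P, ∀ n : ℕ, 0 < n → a ∉ sampleMeanSet fun i : Fin n => θ i ω := by
  refine ae_all_iff.2 fun n => ?_
  rcases Nat.eq_zero_or_pos n with rfl | hn
  · simp
  have hm : Measurable fun x : S1 => unwrap (a - x) := measurable_unwrap.comp (by fun_prop)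
  have hind : iIndepFun (fun i ω => unwrap (a - θ i ω)) P := hindep.comp (fun _ x => unwrap (a - x))
    fun _ => hm
  have hmeas : ∀ i, AEMeasurable (fun ω => unwrap (a - θ i ω)) P := fun i =>
    hm.comp_aemeasurable (hlaw i).aemeasurable
  -- If `a` were a sample mean, the atomless variable `unwrap (a - θ 0 ω)` would equal minus the sum
  -- of the other terms, which is independent of it.
  have h1 := (hind.indepFun_finsetSum_of_notMem₀ hmeas (s := (Finset.range n).erase 0) (i := 0)
    (Finset.notMem_erase _ _)).symm
  have h2 := h1.comp measurable_id (measurable_neg (G := ℝ))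
  have hna : NullSingletonClass (P.map (fun ω => unwrap (a - θ 0 ω))) := by
    refine ⟨fun x => ?_⟩
    rw [Measure.map_apply_of_aemeasurable (hmeas 0) (measurableSet_singleton x)]
    have h3 := (hlaw 0).measure_eq (p := fun y => unwrap (a - y) = x)
      (hm (measurableSet_singleton x))
    refine h3.trans (Set.Subsingleton.measure_zero ?_ _)
    intro y hy z hz
    have h4 := unwrap_injective (hy.trans hz.symm)
    simpa using h4
  filter_upwards [ae_ne_of_indepFun (hmeas 0) ((Finset.aemeasurable_sum (f := fun i ω => unwrap (a - θ i ω)) _ fun i _ => hmeas i).neg) h2]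
    with ω hω _ hmem
  apply hω
  have h5 := sum_unwrap_eq_zero hn hmem
  rw [← Finset.sum_range (fun i => unwrap (a - θ i ω)),
    ← Finset.add_sum_erase _ _ (Finset.mem_range.2 hn)] at h5
  rw [Pi.neg_apply, Finset.sum_apply]
  linarith

end Sample

/-! ### Strong consistency -/

theorem abs_dist_sq_sub_le (μ ν y : S1) : |dist μ y ^ 2 - dist ν y ^ 2| ≤ 2 * π * dist μ ν := by
  have h1 := abs_dist_sub_le μ ν y
  have h2 : |dist μ y + dist ν y| ≤ 2 * π := by
    rw [abs_of_nonneg (by positivity)]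
    linarith [dist_le_pi μ y, dist_le_pi ν y]
  rw [sq_sub_sq, abs_mul]
  exact mul_le_mul h2 h1 (abs_nonneg _) two_pi_pos.le

theorem abs_frechet_sub_le {n : ℕ} (hn : 0 < n) (x : Fin n → S1) (μ ν : S1) :
    |frechet x μ - frechet x ν| ≤ 2 * π * dist μ ν := by
  have hn' : (n : ℝ) ≠ 0 := by positivity
  rw [frechet, frechet, ← mul_sub, ← Finset.sum_sub_distrib, abs_mul, abs_of_nonneg (by positivity)]
  calc (n : ℝ)⁻¹ * |∑ i, (dist μ (x i) ^ 2 - dist ν (x i) ^ 2)|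
      ≤ (n : ℝ)⁻¹ * ∑ _i : Fin n, 2 * π * dist μ ν := by
        gcongr
        exact (Finset.abs_sum_le_sum_abs _ _).trans
          (Finset.sum_le_sum fun i _ => abs_dist_sq_sub_le _ _ _)
    _ = 2 * π * dist μ ν := by
        simp only [Finset.sum_const, Finset.card_univ, Fintype.card_fin, nsmul_eq_mul]
        field_simp

/-- The population Fréchet function of `gN(μs, γs)`. -/
def popFrechet (μs : S1) (γs : ℝ) (μ : S1) : ℝ := ∫ y, dist μ y ^ 2 ∂(gN μs γs)

theorem abs_popFrechet_sub_le (μs : S1) (γs : ℝ) (μ ν : S1) :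
    |popFrechet μs γs μ - popFrechet μs γs ν| ≤ 2 * π * dist μ ν := by
  rw [popFrechet, popFrechet, ← integral_sub (integrable_of_continuous (by fun_prop))
    (integrable_of_continuous (by fun_prop)), ← Real.norm_eq_abs]
  refine (norm_integral_le_of_norm_le_const (C := 2 * π * dist μ ν)
    (Eventually.of_forall fun y => abs_dist_sq_sub_le μ ν y)).trans_eq ?_
  simp

theorem continuous_popFrechet (μs : S1) (γs : ℝ) : Continuous (popFrechet μs γs) := by
  refine (LipschitzWith.of_dist_le_mul (K := ⟨2 * π, two_pi_pos.le⟩) fun μ ν => ?_).continuous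
  rw [Real.dist_eq]
  exact abs_popFrechet_sub_le μs γs μ ν

theorem popFrechet_self (μs : S1) {γs : ℝ} (hγs : 0 < γs) : popFrechet μs γs μs = V γs := by
  rw [V_eq hγs, ← integral_pow_truncGauss, ← (hasLaw_unwrap_sub μs γs).integral_comp
    (by fun_prop), popFrechet]
  refine integral_congr_ae (Eventually.of_forall fun y => ?_)
  simp only [Function.comp]
  rw [← sq_abs (unwrap _), abs_unwrap_sub, dist_comm]

theorem gNPDF_nonneg (μ : S1) (γ : ℝ) (x : S1) : 0 ≤ gNPDF μ γ x :=
  mul_nonneg (inv_nonneg.2 (k_pos γ).le) (exp_pos _).le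

theorem integral_gN (μ : S1) (γ : ℝ) (g : S1 → ℝ) :
    ∫ y, g y ∂(gN μ γ) = ∫ y, gNPDF μ γ y * g y := by
  rw [gN, integral_withDensity_eq_integral_toReal_smul (by fun_prop)
    (Eventually.of_forall fun _ => ENNReal.ofReal_lt_top)]
  refine integral_congr_ae (Eventually.of_forall fun y => ?_)
  simp only [ENNReal.toReal_ofReal (gNPDF_nonneg μ γ y), smul_eq_mul]

theorem gNPDF_le_iff {γ : ℝ} (hγ : 0 < γ) (μ ν y : S1) :
    gNPDF μ γ y ≤ gNPDF ν γ y ↔ dist ν y ^ 2 ≤ dist μ y ^ 2 := by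
  rw [gNPDF, gNPDF, mul_le_mul_iff_right₀ (inv_pos.2 (k_pos γ)), Real.exp_le_exp, neg_mul, neg_mul,
    neg_le_neg_iff, mul_le_mul_iff_right₀ (by positivity)]

/-- The population Fréchet function is uniquely minimized at the location parameter. -/
theorem popFrechet_lt {μs : S1} {γs : ℝ} (hγs : 0 < γs) {μ : S1} (hμ : μ ≠ μs) :
    popFrechet μs γs μs < popFrechet μs γs μ := by
  set D : S1 → ℝ := fun y => dist μ y ^ 2 - dist μs y ^ 2 with hD
  have hDc : Continuous D := by fun_prop
  have h1 : popFrechet μs γs μ - popFrechet μs γs μs = ∫ y, gNPDF μs γs y * D y := by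
    rw [← integral_gN, popFrechet, popFrechet, ← integral_sub]
    all_goals exact integrable_of_continuous (by fun_prop)
  -- The reflection `y ↦ μ + μs - y` exchanges `μ` and `μs`, hence exchanges the two densities and
  -- negates `D`. Twice the difference of Fréchet values thus becomes the integral of `(gNPDF μs -
  -- gNPDF μ) * D`, whose factors always agree in sign.
  have e1 : ∀ y, dist μ (μ + μs - y) = dist μs y := fun y => by
    rw [dist_eq_norm, dist_comm, dist_eq_norm]
    congr 1
    abel
  have e2 : ∀ y, dist μs (μ + μs - y) = dist μ y := fun y => by
    rw [dist_eq_norm, dist_comm, dist_eq_norm]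
    congr 1
    abel
  have h2 : ∫ y, gNPDF μs γs y * D y = -∫ y, gNPDF μ γs y * D y := by
    rw [← integral_neg, ← integral_sub_left_eq_self (fun y => gNPDF μs γs y * D y) volume (μ + μs)]
    refine integral_congr_ae (Eventually.of_forall fun y => ?_)
    simp only [hD, e1, e2, gNPDF]
    ring
  have hc : Continuous fun y => (gNPDF μs γs y - gNPDF μ γs y) * D y := by fun_prop
  have h3 : ∫ y, (gNPDF μs γs y - gNPDF μ γs y) * D y
      = 2 * ∫ y, gNPDF μs γs y * D y := by
    simp only [sub_mul]
    rw [integral_sub, h2]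
    · ring
    all_goals exact integrable_of_continuous (by fun_prop)
  have hnn : ∀ y, 0 ≤ (gNPDF μs γs y - gNPDF μ γs y) * D y := by
    intro y
    rcases le_total (dist μs y ^ 2) (dist μ y ^ 2) with h | h
    · exact mul_nonneg (sub_nonneg.2 ((gNPDF_le_iff hγs _ _ _).2 h)) (sub_nonneg.2 h)
    · exact mul_nonneg_of_nonpos_of_nonpos (sub_nonpos.2 ((gNPDF_le_iff hγs _ _ _).2 h))
        (sub_nonpos.2 h)
  have hd : 0 < dist μ μs ^ 2 := by
    have := dist_pos.2 hμ
    positivity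
  have hpos : 0 < ∫ y, (gNPDF μs γs y - gNPDF μ γs y) * D y := by
    refine hc.integral_pos_of_hasCompactSupport_nonneg_nonzero
      (HasCompactSupport.of_compactSpace _) hnn (x := μs) (ne_of_gt (mul_pos ?_ ?_))
    · rw [sub_pos, ← not_le, gNPDF_le_iff hγs, dist_self]
      simpa using hμ
    · simpa only [hD, dist_self, zero_pow two_ne_zero, sub_zero] using hd
  rw [h3] at hpos
  linarith

/-- Pointwise convergence of equi-Lipschitz functions on a dense sequence is uniform on the
circle. -/
theorem eventually_forall_abs_sub_lt {f : ℕ → S1 → ℝ} {F : S1 → ℝ} {L : ℝ} (hL : 0 < L)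
    (hf : ∀ᶠ n in atTop, ∀ μ ν, |f n μ - f n ν| ≤ L * dist μ ν)
    (hF : ∀ μ ν, |F μ - F ν| ≤ L * dist μ ν)
    (hlim : ∀ j : ℕ, Tendsto (fun n => f n (TopologicalSpace.denseSeq S1 j)) atTop
      (𝓝 (F (TopologicalSpace.denseSeq S1 j)))) {ε : ℝ} (hε : 0 < ε) :
    ∀ᶠ n in atTop, ∀ μ, |f n μ - F μ| < ε := by
  have hr : 0 < ε / (3 * L) := by positivity
  obtain ⟨t, ht⟩ := isCompact_univ.elim_finite_subcover
    (fun j : ℕ => Metric.ball (TopologicalSpace.denseSeq S1 j) (ε / (3 * L)))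
    (fun j => Metric.isOpen_ball) fun μ _ => by
      obtain ⟨j, hj⟩ := (TopologicalSpace.denseRange_denseSeq S1).exists_dist_lt μ hr
      exact mem_iUnion.2 ⟨j, hj⟩
  have hev : ∀ᶠ n in atTop, ∀ j ∈ t,
      |f n (TopologicalSpace.denseSeq S1 j) - F (TopologicalSpace.denseSeq S1 j)| < ε / 3 :=
    (Filter.eventually_all_finset t).2 fun j _ => by
      have := (hlim j).eventually (Metric.ball_mem_nhds _ (show 0 < ε / 3 by positivity))
      filter_upwards [this] with n hn
      rwa [Real.dist_eq] at hn
  filter_upwards [hf, hev] with n hn hn' μ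
  obtain ⟨j, hj, hμ⟩ := mem_iUnion₂.1 (ht (mem_univ μ))
  set y := TopologicalSpace.denseSeq S1 j
  have hLd : L * dist μ y < ε / 3 := by
    rw [Metric.mem_ball, lt_div_iff₀ (by positivity)] at hμ
    linarith
  have h1 := abs_lt.1 ((hn μ y).trans_lt hLd)
  have h2 := abs_lt.1 ((hF μ y).trans_lt hLd)
  have h3 := abs_lt.1 (hn' j hj)
  rw [abs_lt]
  constructor <;> linarith [h1.1, h1.2, h2.1, h2.2, h3.1, h3.2]

section Sample

variable {Ω : Type*} [MeasurableSpace Ω] {P : Measure Ω} {μs : S1} {γs : ℝ} {θ : ℕ → Ω → S1}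

theorem frechet_sample_eq (x : ℕ → S1) (n : ℕ) (μ : S1) :
    frechet (fun i : Fin n => x i) μ = (∑ i ∈ Finset.range n, dist μ (x i) ^ 2) / n := by
  rw [frechet, Finset.sum_range, div_eq_inv_mul]

theorem ae_eventually_frechet_close (hlaw : ∀ i, HasLaw (θ i) (gN μs γs) P)
    (hindep : iIndepFun θ P) :
    ∀ᵐ ω ∂P, ∀ ε > 0, ∀ᶠ n : ℕ in atTop, ∀ μ,
      |frechet (fun i : Fin n => θ i ω) μ - popFrechet μs γs μ| < ε := by
  have h : ∀ μ : S1, ∀ᵐ ω ∂P, Tendsto (fun n : ℕ => frechet (fun i : Fin n => θ i ω) μ) atTop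
      (𝓝 (popFrechet μs γs μ)) := by
    intro μ
    have hm : Continuous fun y : S1 => dist μ y ^ 2 := by fun_prop
    have hid : ∀ i, IdentDistrib (fun ω => dist μ (θ i ω) ^ 2) (fun ω => dist μ (θ 0 ω) ^ 2) P P :=
      fun i => IdentDistrib.comp ⟨(hlaw i).aemeasurable, (hlaw 0).aemeasurable,
        (hlaw i).map_eq.trans (hlaw 0).map_eq.symm⟩ hm.measurable
    have hint : Integrable (fun ω => dist μ (θ 0 ω) ^ 2) P := by
      have h1 : Integrable (fun y => dist μ y ^ 2) (P.map (θ 0)) := by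
        rw [(hlaw 0).map_eq]
        exact integrable_of_continuous hm
      exact h1.comp_aemeasurable (hlaw 0).aemeasurable
    have hind := hindep.comp (fun _ y => dist μ y ^ 2) fun _ => hm.measurable
    have hs := strong_law_ae_real (fun i ω => dist μ (θ i ω) ^ 2) hint
      (fun i j hij => hind.indepFun hij) hid
    have hE : P[fun ω => dist μ (θ 0 ω) ^ 2] = popFrechet μs γs μ :=
      (hlaw 0).integral_comp hm.aestronglyMeasurable
    rw [hE] at hs
    filter_upwards [hs] with ω hω
    simpa only [frechet_sample_eq fun i => θ i ω] using hω
  have h' := ae_all_iff.2 fun j : ℕ => h (TopologicalSpace.denseSeq S1 j)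
  filter_upwards [h'] with ω hω ε hε
  refine eventually_forall_abs_sub_lt two_pi_pos ?_ (abs_popFrechet_sub_le μs γs) hω hε
  filter_upwards [eventually_gt_atTop 0] with n hn using abs_frechet_sub_le hn _

/-- Outside an open neighbourhood of `μs`, compactness keeps the population Fréchet function a fixed
gap above its minimum. A uniform error below half that gap leaves no sample mean there. -/
theorem ae_eventually_sampleMeanSet_subset (hγs : 0 < γs) (hlaw : ∀ i, HasLaw (θ i) (gN μs γs) P)
    (hindep : iIndepFun θ P) :
    ∀ᵐ ω ∂P, ∀ U ∈ 𝓝 μs, ∀ᶠ n : ℕ in atTop, sampleMeanSet (fun i : Fin n => θ i ω) ⊆ U := by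
  filter_upwards [ae_eventually_frechet_close hlaw hindep] with ω hω U hU
  obtain ⟨O, hOU, hO, hμO⟩ := mem_nhds_iff.1 hU
  rcases (Oᶜ).eq_empty_or_nonempty with he | hne
  · refine Eventually.of_forall fun n => ?_
    rw [compl_empty_iff] at he
    exact fun μ _ => hOU (he ▸ mem_univ μ)
  · obtain ⟨m, hm, hmin⟩ := hO.isClosed_compl.isCompact.exists_isMinOn hne
      (continuous_popFrechet μs γs).continuousOn
    have hlt := popFrechet_lt hγs (μ := m) (μs := μs) fun h => hm (h ▸ hμO)
    filter_upwards [hω ((popFrechet μs γs m - popFrechet μs γs μs) / 2) (by linarith)] with n hn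
    intro μ hμ
    by_contra hμU
    have h1 : popFrechet μs γs m ≤ popFrechet μs γs μ := hmin fun h => hμU (hOU h)
    have h2 := (abs_lt.1 (hn μ)).1
    have h3 := (abs_lt.1 (hn μs)).2
    have h4 := hμ μs
    linarith

theorem ae_tendsto_sampleVar (hγs : 0 < γs) (hlaw : ∀ i, HasLaw (θ i) (gN μs γs) P)
    (hindep : iIndepFun θ P) :
    ∀ᵐ ω ∂P, Tendsto (fun n : ℕ => sampleVar (fun i : Fin n => θ i ω)) atTop (𝓝 (V γs)) := by
  filter_upwards [ae_eventually_frechet_close hlaw hindep] with ω hω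
  refine Metric.tendsto_nhds.2 fun ε hε => ?_
  filter_upwards [hω ε hε] with n hn
  obtain ⟨m, hm⟩ := sampleMeanSet_nonempty fun i : Fin n => θ i ω
  have hmin : popFrechet μs γs μs ≤ popFrechet μs γs m := by
    rcases eq_or_ne m μs with rfl | h
    · exact le_rfl
    · exact (popFrechet_lt hγs h).le
  have h1 := (abs_lt.1 (hn m)).1
  have h2 := (abs_lt.1 (hn μs)).2
  have h3 := hm μs
  rw [Real.dist_eq, ← frechet_eq_sampleVar _ hm, ← popFrechet_self μs hγs, abs_lt]
  constructor <;> linarith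

theorem tendsto_VInv (hγs : 0 < γs) {s : ℕ → ℝ} (hs : Tendsto s atTop (𝓝 (V γs)))
    (hmem : ∀ᶠ n in atTop, s n ∈ V '' Ioi 0) : Tendsto (fun n => VInv (s n)) atTop (𝓝 γs) := by
  refine tendsto_order.2 ⟨fun a ha => ?_, fun b hb => ?_⟩
  -- The maximum with `γs / 2` keeps the comparison point in `(0, ∞)`, where `V` is strictly
  -- decreasing.
  · have ha' : 0 < max a (γs / 2) := lt_max_of_lt_right (by positivity)
    have h1 : V γs < V (max a (γs / 2)) := strictAntiOn_V ha' hγs (max_lt ha (by linarith))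
    filter_upwards [hs.eventually_lt_const h1, hmem] with n hn hm
    refine (le_max_left a (γs / 2)).trans_lt ?_
    rw [← V_VInv hm] at hn
    exact (strictAntiOn_V.lt_iff_gt (VInv_pos hm) ha').1 hn
  · have hb' : 0 < b := hγs.trans hb
    have h1 : V b < V γs := strictAntiOn_V hγs hb' hb
    filter_upwards [hs.eventually_const_lt h1, hmem] with n hn hm
    rw [← V_VInv hm] at hn
    exact (strictAntiOn_V.lt_iff_gt hb' (VInv_pos hm)).1 hn

theorem ae_eventually_mleSet_subset [IsProbabilityMeasure P] (hγs : 0 < γs)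
    (hlaw : ∀ i, HasLaw (θ i) (gN μs γs) P)
    (hindep : iIndepFun θ P) :
    ∀ᵐ ω ∂P, ∀ U ∈ 𝓝 (μs, γs), ∀ᶠ n : ℕ in atTop,
      (mleSet fullParam (fun i : Fin n => θ i ω)).Nonempty ∧
        mleSet fullParam (fun i : Fin n => θ i ω) ⊆ U := by
  filter_upwards [ae_eventually_sampleMeanSet_subset hγs hlaw hindep,
    ae_tendsto_sampleVar hγs hlaw hindep, ae_exists_ne hlaw hindep] with ω h1 h2 h3 U hU
  obtain ⟨A, hA, B, hB, hAB⟩ := mem_nhds_prod_iff.1 hU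
  have h4 := tendsto_VInv hγs h2 (by
    filter_upwards [eventually_ge_atTop 2] with n hn using sampleVar_mem_image_V (h3 n hn))
  filter_upwards [h1 A hA, h4.eventually hB, eventually_ge_atTop 2] with n hnA hnB hn
  rw [mleSet_fullParam (h3 n hn)]
  exact ⟨(sampleMeanSet_nonempty _).prod (singleton_nonempty _),
    (prod_mono hnA (singleton_subset_iff.2 hnB)).trans hAB⟩

end Sample

/-! ### Fisher information -/

theorem integral_lin_truncGauss {γ : ℝ} (hγ : 0 < γ) (a b : ℝ) :
    ∫ t, (a * t + b * (t ^ 2 - V γ)) ∂(truncGauss γ) = 0 := by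
  have h1 := integral_pow_truncGauss γ 1
  have h2 := integral_pow_truncGauss γ 2
  rw [gaussMoment_odd odd_one, zero_div] at h1
  simp only [pow_one] at h1
  rw [← V_eq hγ] at h2
  rw [integral_add, integral_const_mul, integral_const_mul, integral_sub, h1, h2]
  · simp
  all_goals exact integrable_of_continuous_truncGauss (by fun_prop)

/-- The covariance structure of `(Y, Y²)` for `Y` truncated Normal. -/
theorem integral_lin_mul_lin_truncGauss {γ : ℝ} (hγ : 0 < γ) (a b c d : ℝ) :
    ∫ t, (a * t + b * (t ^ 2 - V γ)) * (c * t + d * (t ^ 2 - V γ)) ∂(truncGauss γ)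
      = a * c * V γ + 4 * (b * d) * J2 γ := by
  have h1 := integral_pow_truncGauss γ 1
  have h2 := integral_pow_truncGauss γ 2
  have h3 := integral_pow_truncGauss γ 3
  have h4 := integral_pow_truncGauss γ 4
  rw [gaussMoment_odd odd_one, zero_div] at h1
  rw [gaussMoment_odd (by decide), zero_div] at h3
  rw [← V_eq hγ] at h2
  have hJ := J2_eq γ
  rw [← V_eq hγ] at hJ
  have e : ∀ t : ℝ, (a * t + b * (t ^ 2 - V γ)) * (c * t + d * (t ^ 2 - V γ))
      = a * c * t ^ 2 + (a * d + b * c) * t ^ 3 - (a * d + b * c) * V γ * t ^ 1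
        + b * d * t ^ 4 - 2 * (b * d) * V γ * t ^ 2 + b * d * V γ ^ 2 := fun t => by ring
  simp only [e]
  rw [integral_add, integral_sub, integral_add, integral_sub, integral_add]
  · simp only [integral_const_mul, h1, h2, h3, h4, integral_const, probReal_univ, smul_eq_mul]
    rw [hJ]
    ring
  all_goals exact integrable_of_continuous_truncGauss (by fun_prop)

theorem log_gNPDF (μ : S1) (γ : ℝ) (x : S1) :
    log (gNPDF μ γ x) = -log (k γ) - γ / 2 * dist μ x ^ 2 := by
  rw [gNPDF, Real.log_mul (inv_ne_zero (k_pos γ).ne') (exp_pos _).ne', Real.log_inv, Real.log_exp]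
  ring

theorem score_one (μ : S1) {γ : ℝ} (hγ : 0 < γ) (x : S1) :
    score μ γ x 1 = -(1 / 2) * (unwrap (x - μ) ^ 2 - V γ) := by
  have h : HasDerivAt (fun g => log (gNPDF μ g x))
      (-(-(1 / 2) * gaussMoment 2 γ / k γ) - 1 / 2 * dist μ x ^ 2) γ := by
    simp only [log_gNPDF]
    exact ((hasDerivAt_k γ).log (k_pos γ).ne').neg.sub
      (((hasDerivAt_id γ).div_const 2).mul_const _)
  change deriv (fun g => log (gNPDF μ g x)) γ = _
  rw [h.deriv, V_eq hγ, ← sq_abs (unwrap _), abs_unwrap_sub, dist_comm]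
  ring

/-- Away from the antipode the squared distance is locally `(t - y) ^ 2`. The excluded point is null
by `ae_unwrap_ne_pi`. -/
theorem score_zero (μ : S1) (γ : ℝ) {x : S1} (hx : unwrap (x - μ) ≠ π) :
    score μ γ x 0 = γ * unwrap (x - μ) := by
  set y := unwrap (x - μ) with hy
  have hy1 : -π < y := (unwrap_mem _).1
  have hy2 : y < π := (unwrap_mem _).2.lt_of_ne hx
  have hev : (fun t : ℝ => log (gNPDF (μ + (t : S1)) γ x)) =ᶠ[𝓝 0]
      fun t => -log (k γ) - γ / 2 * (t - y) ^ 2 := by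
    have hc : Tendsto (fun t : ℝ => |t - y|) (𝓝 0) (𝓝 |0 - y|) :=
      Continuous.tendsto (by fun_prop) 0
    filter_upwards [hc.eventually_lt_const (u := π)
      (by rw [zero_sub, abs_neg]; exact abs_lt.2 ⟨hy1, hy2⟩)] with t ht
    have e : μ + (t : S1) - x = ((t - y : ℝ) : S1) := by
      rw [AddCircle.coe_sub, hy, coe_unwrap]
      abel
    rw [log_gNPDF, dist_eq_norm, e, norm_coe_of_abs_le ht.le, sq_abs]
  have hd : HasDerivAt (fun t : ℝ => -log (k γ) - γ / 2 * (t - y) ^ 2) (γ * y) 0 := by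
    have h1 := ((((hasDerivAt_id (0 : ℝ)).sub_const y).pow 2).const_mul (γ / 2)).const_sub
      (-log (k γ))
    convert! h1 using 1
    simp
    ring
  change deriv (fun t : ℝ => log (gNPDF (μ + (t : S1)) γ x)) 0 = _
  rw [hev.deriv_eq, hd.deriv]

theorem ae_unwrap_ne_pi (μ : S1) (γ : ℝ) : ∀ᵐ x ∂(gN μ γ), unwrap (x - μ) ≠ π := by
  have h := (hasLaw_unwrap_sub μ γ).measure_eq (p := fun t => t = π) (measurableSet_singleton _)
  rw [ae_iff]
  simp only [ne_eq, not_not]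
  rw [h]
  exact measure_singleton π

theorem fisherInfo_eq (μ : S1) {γ : ℝ} (hγ : 0 < γ) : fisherInfo μ γ = J γ := by
  -- Both score components are written as combinations of `Y` and `Y² - V`, so that one covariance
  -- formula yields all four entries.
  have hs : ∀ᵐ x ∂(gN μ γ), ∀ a : Fin 2, score μ γ x a
      = ![γ, 0] a * unwrap (x - μ) + ![0, -(1 / 2)] a * (unwrap (x - μ) ^ 2 - V γ) := by
    filter_upwards [ae_unwrap_ne_pi μ γ] with x hx a
    fin_cases a
    · simpa using score_zero μ γ hx
    · simpa using score_one μ hγ x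
  have h : ∀ a b : Fin 2, fisherInfo μ γ a b
      = ![γ, 0] a * ![γ, 0] b * V γ + 4 * (![0, -(1 / 2)] a * ![0, -(1 / 2)] b) * J2 γ := by
    intro a b
    rw [← integral_lin_mul_lin_truncGauss hγ,
      ← (hasLaw_unwrap_sub μ γ).integral_comp (by fun_prop)]
    refine integral_congr_ae ?_
    filter_upwards [hs] with x hx
    rw [hx, hx]
    rfl
  ext a b
  rw [h]
  fin_cases a <;> fin_cases b <;> simp [J, J1_eq hγ]
  · exact Or.inl (pow_two γ).symm
  · ring

theorem posDef_J {γ : ℝ} (hγ : 0 < γ) : (J γ).PosDef := by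
  refine Matrix.PosDef.diagonal fun i => ?_
  fin_cases i
  · exact J1_pos hγ
  · exact J2_pos γ

/-! ### Empirical frequencies near the endpoint of the support -/

/-- A monotone `c` is squeezed between its values at neighbouring points of a grid of mesh `η / s`,
and `hη'` makes the mesh cost at most `ε / s`. The upper bound uses the grid point to the right of
`h`, whence the `+ 1` and the room `η / s` below `δ₀`; in the first cell the lower bound is just `c
≥ 0`. -/
theorem abs_sub_le_of_grid {c H : ℝ → ℝ} (hc : Monotone c) (hc0 : ∀ h, 0 ≤ c h)
    {ρ ε δ δ₀ η s : ℝ} (hρ : 0 ≤ ρ) (hε : 0 < ε) (hη : 0 < η) (hη' : (ρ + ε) * η ≤ ε) (hs : 0 < s)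
    (hH : ∀ h ∈ Icc 0 δ₀, |H h - ρ * h| ≤ ε / 4 * h) (hδ : δ + η / s ≤ δ₀)
    (hgrid : ∀ j : ℕ, 1 ≤ j → j ≤ ⌊δ / (η / s)⌋₊ + 1 →
      |c (j * (η / s)) - H (j * (η / s))| ≤ ε / 4 * (j * (η / s))) :
    ∀ h ∈ Icc 0 δ, |c h - ρ * h| ≤ ε * (h + s⁻¹) := by
  intro h hh
  set w := η / s with hw
  have hw0 : 0 < w := by positivity
  have hρw : (ρ + ε) * w ≤ ε * s⁻¹ := by
    rw [hw, div_eq_mul_inv, ← mul_assoc]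
    gcongr
  have hρw' : ρ * w + ε * w ≤ ε * s⁻¹ := by linarith
  set i := ⌊h / w⌋₊ with hi
  have hle : i ≤ ⌊δ / w⌋₊ := Nat.floor_le_floor (by gcongr; exact hh.2)
  have hi1 : i * w ≤ h := by
    have := Nat.floor_le (div_nonneg hh.1 hw0.le)
    rwa [le_div_iff₀ hw0] at this
  have hi2 : h ≤ (i + 1) * w := by
    have := (Nat.lt_floor_add_one (h / w)).le
    rwa [div_le_iff₀ hw0] at this
  have hεh : 0 ≤ ε * h := mul_nonneg hε.le hh.1
  rw [abs_le]
  constructor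
  · have hlow : (ρ - ε / 2) * (i * w) ≤ c (i * w) := by
      rcases Nat.eq_zero_or_pos i with h0 | hpos
      · rw [h0]
        simpa using hc0 0
      · have h1 := (abs_le.1 (hgrid i hpos (by omega))).1
        have h2 := (abs_le.1 (hH (i * w) ⟨by positivity, by linarith [hh.2]⟩)).1
        linarith
    have h3 := hc hi1
    have h4 : ρ * h ≤ ρ * ((i + 1) * w) := by gcongr
    have h5 : ε * (i * w) ≤ ε * h := by gcongr
    have h6 : 0 ≤ ε * w := by positivity
    nlinarith
  · have hmem : ((i + 1 : ℕ) : ℝ) * w ∈ Icc 0 δ₀ := by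
      refine ⟨by positivity, ?_⟩
      push_cast
      linarith [hh.2]
    have h1 := (abs_le.1 (hgrid (i + 1) (by omega) (by omega))).2
    have h2 := (abs_le.1 (hH _ hmem)).2
    push_cast at h1 h2
    have h3 := hc hi2
    have h4 : ρ * (i * w) ≤ ρ * h := by gcongr
    have h5 : ε * (i * w) ≤ ε * h := by gcongr
    nlinarith

/-- The number of the first `n` observations that are at most `h`. -/
def count {Ω : Type*} (Z : ℕ → Ω → ℝ) (n : ℕ) (h : ℝ) (ω : Ω) : ℝ :=
  ∑ i ∈ Finset.range n, (Iic h).indicator 1 (Z i ω)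

theorem count_nonneg {Ω : Type*} (Z : ℕ → Ω → ℝ) (n : ℕ) (h : ℝ) (ω : Ω) : 0 ≤ count Z n h ω :=
  Finset.sum_nonneg fun _ _ => indicator_nonneg (fun _ _ => zero_le_one) _

theorem monotone_count {Ω : Type*} (Z : ℕ → Ω → ℝ) (n : ℕ) (ω : Ω) : Monotone fun h => count Z n h ω :=
  fun _ _ h => Finset.sum_le_sum fun _ _ =>
    indicator_le_indicator_of_subset (Iic_subset_Iic.2 h) (fun _ => zero_le_one) _

section Empirical

variable {Ω : Type*} [MeasurableSpace Ω] {P : Measure Ω} {Z : ℕ → Ω → ℝ} {ν : Measure ℝ}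

theorem identDistrib_comp_of_hasLaw (hlaw : ∀ i, HasLaw (Z i) ν P) {g : ℝ → ℝ} (hg : Measurable g)
    (i : ℕ) : IdentDistrib (fun ω => g (Z i ω)) (fun ω => g (Z 0 ω)) P P :=
  IdentDistrib.comp ⟨(hlaw i).aemeasurable, (hlaw 0).aemeasurable,
    (hlaw i).map_eq.trans (hlaw 0).map_eq.symm⟩ hg

variable [IsProbabilityMeasure P]

/-- Chebyshev's inequality for sums of a function of i.i.d. random variables. -/
theorem meas_le_abs_sum_sub_le (hlaw : ∀ i, HasLaw (Z i) ν P) (hindep : iIndepFun Z P)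
    {g : ℝ → ℝ} (hg : Measurable g) (hg2 : MemLp g 2 ν) (n : ℕ) {r : ℝ} (hr : 0 < r) :
    P {ω | r ≤ |∑ i ∈ Finset.range n, g (Z i ω) - n * ∫ t, g t ∂ν|}
      ≤ ENNReal.ofReal (n * (∫ t, g t ^ 2 ∂ν) / r ^ 2) := by
  have hmem : ∀ i, MemLp (fun ω => g (Z i ω)) 2 P := fun i => by
    have h := hg2
    rw [← (hlaw i).map_eq] at h
    exact h.comp_of_map (hlaw i).aemeasurable
  have hind := hindep.comp (fun _ => g) fun _ => hg
  have hE : ∀ i, ∫ ω, g (Z i ω) ∂P = ∫ t, g t ∂ν := fun i =>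
    (hlaw i).integral_comp hg.aestronglyMeasurable
  have hV : ∀ i, Var[fun ω => g (Z i ω); P] ≤ ∫ t, g t ^ 2 ∂ν := fun i => by
    refine (variance_le_expectation_sq (hmem i).aestronglyMeasurable).trans_eq ?_
    exact (hlaw i).integral_comp (f := fun t => g t ^ 2) (hg.pow_const 2).aestronglyMeasurable
  have hES : ∫ ω, (∑ i ∈ Finset.range n, fun ω => g (Z i ω)) ω ∂P = n * ∫ t, g t ∂ν := by
    simp only [Finset.sum_apply]
    rw [integral_finsetSum _ fun i _ => (hmem i).integrable one_le_two]
    simp [hE]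
  have hVS : Var[∑ i ∈ Finset.range n, fun ω => g (Z i ω); P] ≤ n * ∫ t, g t ^ 2 ∂ν := by
    rw [IndepFun.variance_sum (fun i _ => hmem i) fun i _ j _ hij => hind.indepFun hij]
    refine (Finset.sum_le_sum fun i _ => hV i).trans_eq ?_
    simp
  have h := meas_ge_le_variance_div_sq (memLp_finsetSum' (Finset.range n) fun i _ => hmem i) hr
  rw [hES] at h
  simp only [Finset.sum_apply] at h
  refine h.trans (ENNReal.ofReal_le_ofReal ?_)
  gcongr

variable [IsProbabilityMeasure ν]

/-- An indicator is its own square, so the Chebyshev bound carries the factor `ν (Iic h)`, which is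
small for small `h`. -/
theorem meas_le_abs_count_sub_le (hlaw : ∀ i, HasLaw (Z i) ν P) (hindep : iIndepFun Z P)
    (n : ℕ) (h : ℝ) {r : ℝ} (hr : 0 < r) :
    P {ω | r ≤ |count Z n h ω - n * ν.real (Iic h)|}
      ≤ ENNReal.ofReal (n * ν.real (Iic h) / r ^ 2) := by
  have hg : Measurable ((Iic h).indicator (1 : ℝ → ℝ)) := measurable_one.indicator measurableSet_Iic
  have h1 := meas_le_abs_sum_sub_le hlaw hindep hg
    (MemLp.of_bound hg.aestronglyMeasurable 1 (Eventually.of_forall fun t => by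
      by_cases ht : t ∈ Iic h <;> simp [indicator, ht])) n hr
  have e : ∀ t, (Iic h).indicator (1 : ℝ → ℝ) t ^ 2 = (Iic h).indicator 1 t := fun t => by
    by_cases ht : t ∈ Iic h <;> simp [indicator, ht]
  simp only [e, integral_indicator_one measurableSet_Iic] at h1
  exact h1

theorem tendsto_log_div_sqrt (A B : ℝ) :
    Tendsto (fun n : ℕ => A * (B + log n) / √n) atTop (𝓝 0) := by
  have h1 : Tendsto (fun x : ℝ => log x / √x) atTop (𝓝 0) := by
    have := (isLittleO_log_rpow_atTop (r := 1 / 2) (by norm_num)).tendsto_div_nhds_zero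
    simpa only [Real.sqrt_eq_rpow] using this
  have h2 : Tendsto (fun n : ℕ => (√(n : ℝ))⁻¹) atTop (𝓝 0) :=
    tendsto_inv_atTop_zero.comp (Real.tendsto_sqrt_atTop.comp tendsto_natCast_atTop_atTop)
  have h3 := ((h2.const_mul B).add (h1.comp tendsto_natCast_atTop_atTop)).const_mul A
  simp only [mul_zero, add_zero] at h3
  refine h3.congr fun n => ?_
  simp only [Function.comp]
  ring

/-- If the distribution function of i.i.d. observations is linear to first order at `0`, then with
probability tending to one the empirical distribution function is uniformly within `o(h + n^{-1/2})`
of the linear function. -/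
theorem exists_tendsto_meas_count (hlaw : ∀ i, HasLaw (Z i) ν P) (hindep : iIndepFun Z P)
    {ρ : ℝ} (hρ : 0 ≤ ρ)
    (hH : ∀ ε > 0, ∃ δ > 0, ∀ h ∈ Icc 0 δ, |ν.real (Iic h) - ρ * h| ≤ ε * h)
    {ε : ℝ} (hε : 0 < ε) :
    ∃ δ > 0, Tendsto (fun n : ℕ => P {ω | ¬∀ h ∈ Icc 0 δ,
      |count Z n h ω / n - ρ * h| ≤ ε * (h + (√(n : ℝ))⁻¹)}) atTop (𝓝 0) := by
  obtain ⟨δ₀, hδ₀, hH₀⟩ := hH (ε / 4) (by positivity)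
  -- The largest mesh constant with `(ρ + ε) * η ≤ ε`.
  set η := ε / (ρ + ε) with hη
  have hη0 : 0 < η := by positivity
  refine ⟨δ₀ / 2, by positivity, ?_⟩
  -- At `h = j η / √n`, Chebyshev with deviation `n ε h / 4` gives `16 (ρ + ε) / (ε² n h) = C / (√n
  -- j)`. Summed over the grid this is a harmonic sum, at most `C (B + log n) / √n`, which tends to
  -- zero.
  set C := (ρ + ε) * 16 / (ε ^ 2 * η) with hC
  have hC0 : 0 < C := by positivity
  set B := 1 + log (δ₀ / 2 / η + 1) with hB
  have hsqrt : Tendsto (fun n : ℕ => η / √(n : ℝ)) atTop (𝓝 0) :=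
    Tendsto.const_div_atTop (Real.tendsto_sqrt_atTop.comp tendsto_natCast_atTop_atTop) η
  have hlim : Tendsto (fun n : ℕ => ENNReal.ofReal (C * (B + log n) / √n)) atTop (𝓝 0) := by
    simpa using ENNReal.tendsto_ofReal (tendsto_log_div_sqrt C B)
  refine tendsto_of_tendsto_of_tendsto_of_le_of_le' tendsto_const_nhds hlim
    (Eventually.of_forall fun _ => zero_le) ?_
  filter_upwards [eventually_gt_atTop 0, hsqrt.eventually_lt_const (half_pos hδ₀)] with n hn hnδ
  have hn' : (0 : ℝ) < n := by exact_mod_cast hn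
  have hs : 0 < √(n : ℝ) := Real.sqrt_pos.2 hn'
  have hss : √(n : ℝ) * √n = n := Real.mul_self_sqrt hn'.le
  set w := η / √(n : ℝ) with hw
  have hw0 : 0 < w := by positivity
  set N := ⌊δ₀ / 2 / w⌋₊ + 1 with hN
  have hNw : ∀ j ∈ Finset.Icc 1 N, (j : ℝ) * w ∈ Icc 0 δ₀ := by
    intro j hj
    refine ⟨by positivity, ?_⟩
    have h1 : (j : ℝ) ≤ N := by exact_mod_cast (Finset.mem_Icc.1 hj).2
    have h2 := Nat.floor_le (show 0 ≤ δ₀ / 2 / w by positivity)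
    rw [le_div_iff₀ hw0] at h2
    have h3 : (j : ℝ) * w ≤ N * w := by gcongr
    rw [hN] at h3
    push_cast at h3
    linarith
  have hsub : {ω | ¬∀ h ∈ Icc 0 (δ₀ / 2), |count Z n h ω / n - ρ * h| ≤ ε * (h + (√(n : ℝ))⁻¹)} ⊆
      ⋃ j ∈ Finset.Icc 1 N, {ω | n * (ε / 4 * (j * w)) ≤
        |count Z n (j * w) ω - n * ν.real (Iic (j * w))|} := by
    intro ω hω
    by_contra hcon
    refine hω ?_
    refine abs_sub_le_of_grid (c := fun h => count Z n h ω / n) (H := fun h => ν.real (Iic h))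
      (fun a b hab => by
        simp only
        gcongr
        exact monotone_count Z n ω hab)
      (fun h => div_nonneg (count_nonneg _ _ _ _) hn'.le) hρ hε hη0 (le_of_eq (by
        rw [hη]; field_simp)) hs hH₀ (by linarith) fun j hj1 hj2 => ?_
    simp only [mem_iUnion, not_exists, mem_ofPred_eq, not_le] at hcon
    have h1 := hcon j (Finset.mem_Icc.2 ⟨hj1, hj2⟩)
    rw [div_sub' hn'.ne', abs_div, abs_of_pos hn', div_le_iff₀ hn', mul_comm _ (n : ℝ)]
    exact h1.le
  refine (measure_mono hsub).trans ((measure_biUnion_finset_le _ _).trans ?_)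
  have hj : ∀ j ∈ Finset.Icc 1 N, P {ω | n * (ε / 4 * (j * w)) ≤
      |count Z n (j * w) ω - n * ν.real (Iic (j * w))|} ≤
      ENNReal.ofReal (C / √n * (j : ℝ)⁻¹) := by
    intro j hj
    have hj0 : (0 : ℝ) < j := by exact_mod_cast (Finset.mem_Icc.1 hj).1
    have hjw : 0 < (j : ℝ) * w := by positivity
    refine (meas_le_abs_count_sub_le hlaw hindep n (j * w) (by positivity)).trans
      (ENNReal.ofReal_le_ofReal ?_)
    have h1 : ν.real (Iic (j * w)) ≤ (ρ + ε) * (j * w) := by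
      have := (abs_le.1 (hH₀ _ (hNw j hj))).2
      nlinarith [mul_pos hε hjw]
    calc n * ν.real (Iic (j * w)) / (n * (ε / 4 * (j * w))) ^ 2
        ≤ n * ((ρ + ε) * (j * w)) / (n * (ε / 4 * (j * w))) ^ 2 := by gcongr
      _ = C / √n * (j : ℝ)⁻¹ := by
        have h2 : ∀ s m : ℝ, 0 < s → s * s = m →
            m * ((ρ + ε) * (j * (η / s))) / (m * (ε / 4 * (j * (η / s)))) ^ 2
              = (ρ + ε) * 16 / (ε ^ 2 * η) / s * (j : ℝ)⁻¹ := by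
          rintro s _ hs rfl
          field_simp
          ring
        exact h2 _ _ hs hss
  refine (Finset.sum_le_sum hj).trans ?_
  rw [← ENNReal.ofReal_sum_of_nonneg fun j _ => by positivity, ← Finset.mul_sum]
  refine ENNReal.ofReal_le_ofReal ?_
  have hharm : ∑ j ∈ Finset.Icc 1 N, (j : ℝ)⁻¹ ≤ B + log n := by
    have h1 := harmonic_le_one_add_log N
    rw [harmonic_eq_sum_Icc] at h1
    push_cast at h1
    refine h1.trans ?_
    rw [hB, add_assoc, ← Real.log_mul (by positivity) hn'.ne']
    have h2 : (N : ℝ) ≤ (δ₀ / 2 / η + 1) * n := by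
      have h3 := Nat.floor_le (show 0 ≤ δ₀ / 2 / w by positivity)
      have h4 : (1 : ℝ) ≤ n := by exact_mod_cast hn
      have h5 : √(n : ℝ) ≤ n := Real.sqrt_le_iff.2 ⟨hn'.le, by nlinarith⟩
      have h6 : δ₀ / 2 / w = δ₀ / 2 / η * √n := by rw [hw]; field_simp
      have h7 : δ₀ / 2 / η * √n ≤ δ₀ / 2 / η * n := by gcongr
      rw [hN]
      push_cast
      linarith
    have hN0 : (0 : ℝ) < N := by rw [hN]; positivity
    linarith [Real.log_le_log hN0 h2]
  calc C / √n * ∑ j ∈ Finset.Icc 1 N, (j : ℝ)⁻¹ ≤ C / √n * (B + log n) := by gcongr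
    _ = C * (B + log n) / √n := by ring

end Empirical

/-! ### Events of high probability and stochastic boundedness -/

section HighProb

variable {Ω : Type*} [MeasurableSpace Ω] {P : Measure Ω}

/-- The events `E n` have outer probability tending to one. -/
def HighProb (P : Measure Ω) (E : ℕ → Ω → Prop) : Prop :=
  Tendsto (fun n => P {ω | ¬E n ω}) atTop (𝓝 0)

/-- The sequence `S` is bounded in probability. -/
def BoundedInProb (P : Measure Ω) (S : ℕ → Ω → ℝ) : Prop :=
  ∀ τ : ENNReal, 0 < τ → ∃ M > 0, ∀ᶠ n in atTop, P {ω | ¬|S n ω| ≤ M} ≤ τ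

theorem highProb_iff {E : ℕ → Ω → Prop} :
    HighProb P E ↔ ∀ τ : ENNReal, 0 < τ → ∀ᶠ n in atTop, P {ω | ¬E n ω} ≤ τ :=
  ENNReal.tendsto_nhds_zero

theorem HighProb.mono {E F : ℕ → Ω → Prop} (hE : HighProb P E)
    (h : ∀ᶠ n in atTop, ∀ ω, E n ω → F n ω) : HighProb P F := by
  refine highProb_iff.2 fun τ hτ => ?_
  filter_upwards [highProb_iff.1 hE τ hτ, h] with n hn hEF
  exact (measure_mono (show {ω | ¬F n ω} ⊆ {ω | ¬E n ω} from
    fun ω hω h => hω (hEF ω h))).trans hn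

theorem HighProb.and {E F : ℕ → Ω → Prop} (hE : HighProb P E) (hF : HighProb P F) :
    HighProb P fun n ω => E n ω ∧ F n ω := by
  have h := hE.add hF
  rw [add_zero] at h
  refine tendsto_of_tendsto_of_tendsto_of_le_of_le tendsto_const_nhds h (fun _ => zero_le)
    fun n => ?_
  refine (measure_mono fun ω hω => ?_).trans (measure_union_le _ _)
  by_contra hcon
  simp only [mem_union, mem_ofPred_eq, not_or, not_not] at hcon
  exact hω hcon

theorem highProb_of_ae {E : ℕ → Ω → Prop} (h : ∀ᶠ n in atTop, ∀ᵐ ω ∂P, E n ω) : HighProb P E :=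
  tendsto_const_nhds.congr' (h.mono fun _ hn => (ae_iff.1 hn).symm)

theorem BoundedInProb.highProb {S : ℕ → Ω → ℝ} (hS : BoundedInProb P S) {E : ℕ → Ω → Prop}
    (h : ∀ M > 0, HighProb P fun n ω => |S n ω| ≤ M → E n ω) : HighProb P E := by
  refine highProb_iff.2 fun τ hτ => ?_
  have hτ2 : 0 < τ / 2 := ENNReal.half_pos hτ.ne'
  obtain ⟨M, hM, hSM⟩ := hS (τ / 2) hτ2
  filter_upwards [hSM, highProb_iff.1 (h M hM) (τ / 2) hτ2] with n h1 h2
  calc P {ω | ¬E n ω} ≤ P ({ω | ¬|S n ω| ≤ M} ∪ {ω | ¬(|S n ω| ≤ M → E n ω)}) := by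
        refine measure_mono fun ω hω => ?_
        by_contra hcon
        simp only [mem_union, mem_ofPred_eq, not_or, not_not] at hcon
        exact hω (hcon.2 hcon.1)
    _ ≤ τ / 2 + τ / 2 := (measure_union_le _ _).trans (add_le_add h1 h2)
    _ = τ := ENNReal.add_halves τ

/-- Solving an asymptotically linear equation preserves stochastic boundedness. -/
theorem BoundedInProb.of_linear {S T : ℕ → Ω → ℝ} (hS : BoundedInProb P S) {c : ℝ} (hc : 0 < c)
    (h : ∀ ε > 0, HighProb P fun n ω => |c * T n ω - S n ω| ≤ ε * (|T n ω| + 1)) :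
    BoundedInProb P T := by
  intro τ hτ
  have hτ2 : 0 < τ / 2 := ENNReal.half_pos hτ.ne'
  obtain ⟨M, hM, hSM⟩ := hS (τ / 2) hτ2
  -- With error `(c / 2) (|T| + 1)`, half of `c |T|` is absorbed: `c |T| ≤ M + (c / 2) (|T| + 1)`
  -- gives this bound.
  refine ⟨2 * M / c + 1, by positivity, ?_⟩
  filter_upwards [hSM, highProb_iff.1 (h (c / 2) (by positivity)) (τ / 2) hτ2] with n h1 h2
  calc P {ω | ¬|T n ω| ≤ 2 * M / c + 1}
      ≤ P ({ω | ¬|S n ω| ≤ M} ∪ {ω | ¬|c * T n ω - S n ω| ≤ c / 2 * (|T n ω| + 1)}) := by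
        refine measure_mono fun ω hω => ?_
        by_contra hcon
        simp only [mem_union, mem_ofPred_eq, not_or, not_not] at hcon
        refine hω ?_
        have h3 : |c * T n ω| ≤ |c * T n ω - S n ω| + |S n ω| := by
          simpa using abs_add_le (c * T n ω - S n ω) (S n ω)
        rw [abs_mul, abs_of_pos hc] at h3
        rw [← sub_le_iff_le_add, le_div_iff₀ hc]
        linarith [hcon.1, hcon.2]
    _ ≤ τ / 2 + τ / 2 := (measure_union_le _ _).trans (add_le_add h1 h2)
    _ = τ := ENNReal.add_halves τ

/-- `BoundedInProb.of_linear` bounds `T` by some `M` up to small probability; then `ε = a c / (M +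
1)` turns the relative error into the absolute error `a`. -/
theorem highProb_abs_sub_div_le {S T : ℕ → Ω → ℝ} (hS : BoundedInProb P S) {c : ℝ} (hc : 0 < c)
    (h : ∀ ε > 0, HighProb P fun n ω => |c * T n ω - S n ω| ≤ ε * (|T n ω| + 1)) {a : ℝ}
    (ha : 0 < a) : HighProb P fun n ω => |T n ω - S n ω / c| ≤ a := by
  refine (hS.of_linear hc h).highProb fun M hM => ?_
  refine (h (a * c / (M + 1)) (by positivity)).mono (Eventually.of_forall fun n ω hω hM' => ?_)
  have h1 : T n ω - S n ω / c = (c * T n ω - S n ω) / c := by field_simp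
  rw [h1, abs_div, abs_of_pos hc, div_le_iff₀ hc]
  calc |c * T n ω - S n ω| ≤ a * c / (M + 1) * (|T n ω| + 1) := hω
    _ ≤ a * c / (M + 1) * (M + 1) := by gcongr
    _ = a * c := by field_simp

theorem highProb_abs_sub_le_of_tendsto_ae [IsProbabilityMeasure P] {f : ℕ → Ω → ℝ} {a : ℝ}
    (hf : ∀ n, AEMeasurable (f n) P) (h : ∀ᵐ ω ∂P, Tendsto (fun n => f n ω) atTop (𝓝 a)) {ε : ℝ}
    (hε : 0 < ε) : HighProb P fun n ω => |f n ω - a| ≤ ε := by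
  have h1 := tendstoInMeasure_iff_dist.1 (tendstoInMeasure_of_tendsto_ae (μ := P) (g := fun _ => a)
    (fun n => (hf n).aestronglyMeasurable) h) ε hε
  refine tendsto_of_tendsto_of_tendsto_of_le_of_le tendsto_const_nhds h1 (fun _ => zero_le)
    fun n => measure_mono fun ω hω => ?_
  exact (not_le.1 hω).le

theorem boundedInProb_sum [IsProbabilityMeasure P] {Z : ℕ → Ω → ℝ} {ν : Measure ℝ}
    (hlaw : ∀ i, HasLaw (Z i) ν P)
    (hindep : iIndepFun Z P) {g : ℝ → ℝ} (hg : Measurable g) (hg2 : MemLp g 2 ν)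
    (h0 : ∫ t, g t ∂ν = 0) :
    BoundedInProb P fun n ω => (√(n : ℝ))⁻¹ * ∑ i ∈ Finset.range n, g (Z i ω) := by
  intro τ hτ
  set E := ∫ t, g t ^ 2 ∂ν with hE
  have hlim : Tendsto (fun M : ℝ => ENNReal.ofReal (E / M ^ 2)) atTop (𝓝 0) := by
    have h1 : Tendsto (fun M : ℝ => E / M ^ 2) atTop (𝓝 0) :=
      Tendsto.const_div_atTop (tendsto_pow_atTop two_ne_zero) E
    simpa using ENNReal.tendsto_ofReal h1
  obtain ⟨M, hM, hM0⟩ := ((ENNReal.tendsto_nhds_zero.1 hlim τ hτ).and (eventually_gt_atTop 0)).exists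
  refine ⟨M, hM0, ?_⟩
  filter_upwards [eventually_gt_atTop 0] with n hn
  have hn' : (0 : ℝ) < n := by exact_mod_cast hn
  have hs : 0 < √(n : ℝ) := Real.sqrt_pos.2 hn'
  have h1 := meas_le_abs_sum_sub_le hlaw hindep hg hg2 n (mul_pos hs hM0)
  rw [h0, mul_zero, mul_pow, Real.sq_sqrt hn'.le, ← hE, mul_div_mul_left _ _ hn'.ne'] at h1
  simp only [sub_zero] at h1
  refine (measure_mono fun ω hω => ?_).trans (h1.trans hM)
  simp only [mem_ofPred_eq, not_le, abs_mul, abs_inv, abs_of_pos hs] at hω ⊢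
  rw [lt_inv_mul_iff₀ hs] at hω
  exact hω.le

end HighProb

/-! ### The law of the observations near the antipode -/

theorem real_Ioc_truncGauss (γ : ℝ) {a b : ℝ} (ha : -π ≤ a) (hab : a ≤ b) (hb : b ≤ π) :
    (truncGauss γ).real (Ioc a b) = ∫ t in a..b, truncPDF γ t := by
  rw [Measure.real, truncGauss, withDensity_apply _ measurableSet_Ioc,
    Measure.restrict_restrict measurableSet_Ioc,
    inter_eq_left.2 (Ioc_subset_Ioc ha hb), intervalIntegral.integral_of_le hab,
    integral_eq_lintegral_of_nonneg_ae (Eventually.of_forall fun t => truncPDF_nonneg γ t)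
      (by fun_prop)]

/-- The density is continuous at `π` and even; phrasing nearness through `|t|` treats both ends of
the support at once. -/
theorem abs_real_Ioc_truncGauss_sub_le (γ : ℝ) {ε : ℝ} (hε : 0 < ε) :
    ∃ δ > 0, ∀ a b : ℝ, -π ≤ a → a ≤ b → b ≤ π → (∀ t ∈ Ioc a b, π - δ ≤ |t|) →
      |(truncGauss γ).real (Ioc a b) - edgeDensity γ * (b - a)| ≤ ε * (b - a) := by
  have hcont : ContinuousAt (truncPDF γ) π := (continuous_truncPDF γ).continuousAt
  obtain ⟨δ, hδ, h⟩ := Metric.continuousAt_iff.1 hcont ε hε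
  refine ⟨δ / 2, by positivity, fun a b ha hab hb ht => ?_⟩
  have hc : edgeDensity γ * (b - a) = ∫ _t in a..b, edgeDensity γ := by
    rw [intervalIntegral.integral_const, smul_eq_mul, mul_comm]
  rw [real_Ioc_truncGauss γ ha hab hb, hc, ← intervalIntegral.integral_sub
    (Continuous.intervalIntegrable (by fun_prop) _ _)
    (Continuous.intervalIntegrable (by fun_prop) _ _)]
  have := intervalIntegral.norm_integral_le_of_norm_le_const (a := a) (b := b) (C := ε)
    (f := fun t => truncPDF γ t - edgeDensity γ) fun t ht' => ?_
  · rwa [Real.norm_eq_abs, abs_of_nonneg (sub_nonneg.2 hab)] at this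
  · rw [uIoc_of_le hab] at ht'
    have h1 : |t| ≤ π := abs_le.2 ⟨by linarith [ht'.1], by linarith [ht'.2]⟩
    have h2 := ht t ht'
    have h3 := h (x := |t|) (by rw [Real.dist_eq, abs_sub_comm, abs_of_nonneg] <;> linarith)
    rw [Real.dist_eq] at h3
    have h4 : truncPDF γ |t| = truncPDF γ t := by rw [truncPDF, truncPDF, sq_abs]
    rw [h4] at h3
    exact h3.le

theorem real_Iic_map_pi_add (γ : ℝ) {ε : ℝ} (hε : 0 < ε) :
    ∃ δ > 0, ∀ h ∈ Icc 0 δ, |((truncGauss γ).map fun t => π + t).real (Iic h)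
      - edgeDensity γ * h| ≤ ε * h := by
  obtain ⟨δ, hδ, H⟩ := abs_real_Ioc_truncGauss_sub_le γ hε
  refine ⟨min δ π, lt_min hδ pi_pos, fun h hh => ?_⟩
  have h1 := le_min_iff.1 hh.2
  have h2 := H (-π) (h - π) le_rfl (by linarith [hh.1]) (by linarith [pi_pos]) fun t ht => by
    rw [abs_of_nonpos (by linarith [ht.2])]
    linarith [ht.2]
  have h3 : ((truncGauss γ).map fun t => π + t).real (Iic h)
      = (truncGauss γ).real (Ioc (-π) (h - π)) := by
    rw [map_measureReal_apply (by fun_prop) measurableSet_Iic]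
    refine measureReal_congr ?_
    filter_upwards [ae_mem_truncGauss γ] with t ht
    refine propext ⟨fun h => ⟨ht.1, ?_⟩, fun h => ?_⟩
    · have : π + t ≤ _ := h
      linarith
    · change π + t ≤ _
      linarith [h.2]
  rw [h3]
  simpa using h2

theorem real_Iic_map_pi_sub (γ : ℝ) {ε : ℝ} (hε : 0 < ε) :
    ∃ δ > 0, ∀ h ∈ Icc 0 δ, |((truncGauss γ).map fun t => π - t).real (Iic h)
      - edgeDensity γ * h| ≤ ε * h := by
  obtain ⟨δ, hδ, H⟩ := abs_real_Ioc_truncGauss_sub_le γ hε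
  refine ⟨min δ π, lt_min hδ pi_pos, fun h hh => ?_⟩
  have h1 := le_min_iff.1 hh.2
  have h2 := H (π - h) π (by linarith [pi_pos]) (by linarith [hh.1]) le_rfl fun t ht => by
    rw [abs_of_nonneg (by linarith [ht.1])]
    linarith [ht.1]
  have h3 : ((truncGauss γ).map fun t => π - t).real (Iic h)
      = (truncGauss γ).real (Ioc (π - h) π) := by
    rw [map_measureReal_apply (by fun_prop) measurableSet_Iic]
    refine measureReal_congr ?_
    -- The event `π - t ≤ h` contains the endpoint `π - h`, which `Ioc` omits; it carries no mass.
    have hne : ∀ᵐ t ∂(truncGauss γ), t ≠ π - h := by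
      rw [ae_iff]
      simp
    filter_upwards [ae_mem_truncGauss γ, hne] with t ht hne
    refine propext ⟨fun h' => ⟨lt_of_le_of_ne ?_ hne.symm, ht.2⟩, fun h' => ?_⟩
    · have : π - t ≤ _ := h'
      linarith
    · change π - t ≤ _
      linarith [h'.1]
  rw [h3]
  simpa using h2

/-! ### The estimating equation for the sample mean -/

/-- Here `a - y` lies in `[-π, 2π)` and needs a shift by `-2π` once it reaches `π`. The boundary
values would represent the antipode, which `hne` excludes. -/
theorem unwrap_sub_eq_of_nonneg {μs μ x : S1} (hne : unwrap (μ - x) ≠ π)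
    (h : 0 ≤ unwrap (μ - μs)) :
    unwrap (μ - x) = unwrap (μ - μs) - unwrap (x - μs)
      - 2 * π * (Iic (unwrap (μ - μs))).indicator 1 (π + unwrap (x - μs)) := by
  set a := unwrap (μ - μs) with ha
  set y := unwrap (x - μs) with hy
  have hcoe : ((a - y : ℝ) : S1) = μ - x := by
    rw [AddCircle.coe_sub, ha, hy, coe_unwrap, coe_unwrap]
    abel
  have hcoe' : ((a - y - 2 * π : ℝ) : S1) = μ - x := by
    rw [AddCircle.coe_sub, AddCircle.coe_period, sub_zero, hcoe]
  have ha1 : a ≤ π := (unwrap_mem _).2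
  have hy1 : -π < y := (unwrap_mem _).1
  have hy2 : y ≤ π := (unwrap_mem _).2
  have hnp : ∀ v : ℝ, (v : S1) = μ - x → v ≠ -π := fun v hv hv' => by
    apply hne
    rw [← hv, hv', coe_neg_pi, unwrap_coe ⟨by linarith [pi_pos], le_rfl⟩]
  by_cases hc : π + y ≤ a
  · rw [indicator_of_mem (mem_Iic.2 hc), Pi.one_apply, mul_one, ← hcoe', unwrap_coe]
    exact ⟨lt_of_le_of_ne (by linarith) (hnp _ hcoe').symm, by linarith⟩
  · rw [indicator_of_notMem (by simpa using hc), mul_zero, sub_zero, ← hcoe, unwrap_coe]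
    exact ⟨lt_of_le_of_ne (by linarith) (hnp _ hcoe).symm, by linarith⟩

/-- Here `a - y` lies in `(-2π, π)` and wraps exactly when it is at most `-π`. The boundary value
`-π` is sent to `π`, in agreement with `unwrap`, so antipodal points need no exclusion. -/
theorem unwrap_sub_eq_of_neg {μs μ x : S1} (h : unwrap (μ - μs) < 0) :
    unwrap (μ - x) = unwrap (μ - μs) - unwrap (x - μs)
      + 2 * π * (Iic (-unwrap (μ - μs))).indicator 1 (π - unwrap (x - μs)) := by
  set a := unwrap (μ - μs) with ha
  set y := unwrap (x - μs) with hy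
  have hcoe : ((a - y : ℝ) : S1) = μ - x := by
    rw [AddCircle.coe_sub, ha, hy, coe_unwrap, coe_unwrap]
    abel
  have hcoe' : ((a - y + 2 * π : ℝ) : S1) = μ - x := by
    rw [AddCircle.coe_add, AddCircle.coe_period, add_zero, hcoe]
  have ha1 : -π < a := (unwrap_mem _).1
  have hy1 : -π < y := (unwrap_mem _).1
  have hy2 : y ≤ π := (unwrap_mem _).2
  by_cases hc : π - y ≤ -a
  · rw [indicator_of_mem (mem_Iic.2 hc), Pi.one_apply, mul_one, ← hcoe', unwrap_coe]
    constructor <;> linarith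
  · rw [indicator_of_notMem (by simpa using hc), mul_zero, add_zero, ← hcoe, unwrap_coe]
    constructor <;> linarith

/-- The linearized estimating equation of the intrinsic sample mean. -/
theorem abs_linearized_mean_le {Ω : Type*} {θ : ℕ → Ω → S1} {ω : Ω} {μs μ : S1} {n : ℕ} (hn : 0 < n)
    (hμ : μ ∈ sampleMeanSet fun i : Fin n => θ i ω) {ρ δ R : ℝ}
    (hδ : |unwrap (μ - μs)| ≤ δ)
    (hplus : ∀ h ∈ Icc 0 δ, |count (fun i ω => π + unwrap (θ i ω - μs)) n h ω / n - ρ * h|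
      ≤ R * (h + (√(n : ℝ))⁻¹))
    (hminus : ∀ h ∈ Icc 0 δ, |count (fun i ω => π - unwrap (θ i ω - μs)) n h ω / n - ρ * h|
      ≤ R * (h + (√(n : ℝ))⁻¹)) :
    |n * ((1 - 2 * π * ρ) * unwrap (μ - μs)) - ∑ i ∈ Finset.range n, unwrap (θ i ω - μs)|
      ≤ 2 * π * n * (R * (|unwrap (μ - μs)| + (√(n : ℝ))⁻¹)) := by
  have hn' : (0 : ℝ) < n := by exact_mod_cast hn
  have h0 := sum_unwrap_eq_zero hn hμ
  rw [← Finset.sum_range (fun i => unwrap (μ - θ i ω))] at h0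
  have hne : ∀ i ∈ Finset.range n, unwrap (μ - θ i ω) ≠ π := fun i hi =>
    unwrap_ne_pi_of_mem hμ ⟨i, Finset.mem_range.1 hi⟩
  rcases le_or_gt 0 (unwrap (μ - μs)) with hs | hs
  · rw [abs_of_nonneg hs] at hδ ⊢
    rw [Finset.sum_congr rfl fun i hi => unwrap_sub_eq_of_nonneg (hne i hi) hs,
      Finset.sum_sub_distrib, Finset.sum_sub_distrib, ← Finset.mul_sum, Finset.sum_const,
      Finset.card_range, nsmul_eq_mul] at h0
    have h1 := hplus _ ⟨hs, hδ⟩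
    set c := count (fun i ω => π + unwrap (θ i ω - μs)) n (unwrap (μ - μs)) ω with hc
    -- The first-order condition is `n a - ∑ Y i - 2π c = 0`; only the error of replacing `c` by `n
    -- ρ a` survives.
    have h2 : n * ((1 - 2 * π * ρ) * unwrap (μ - μs)) - ∑ i ∈ Finset.range n, unwrap (θ i ω - μs)
        = 2 * π * n * (c / n - ρ * unwrap (μ - μs)) := by
      rw [hc, count]
      field_simp
      linarith
    rw [h2, abs_mul, abs_of_pos (by positivity)]
    gcongr
  · rw [abs_of_neg hs] at hδ ⊢
    rw [Finset.sum_congr rfl fun i _ => unwrap_sub_eq_of_neg (x := θ i ω) hs,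
      Finset.sum_add_distrib, Finset.sum_sub_distrib, ← Finset.mul_sum, Finset.sum_const,
      Finset.card_range, nsmul_eq_mul] at h0
    have h1 := hminus _ ⟨by linarith, hδ⟩
    set c := count (fun i ω => π - unwrap (θ i ω - μs)) n (-unwrap (μ - μs)) ω with hc
    have h2 : n * ((1 - 2 * π * ρ) * unwrap (μ - μs)) - ∑ i ∈ Finset.range n, unwrap (θ i ω - μs)
        = -(2 * π * n * (c / n - ρ * -unwrap (μ - μs))) := by
      rw [hc, count]
      field_simp
      linarith
    rw [h2, abs_neg, abs_mul, abs_of_pos (by positivity)]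
    gcongr

/-- The sample variance differs from the second sample moment about any point by at most the
squared distance of that point to the sample mean. -/
theorem abs_sum_sq_sub_sampleVar_le {θ : ℕ → S1} {μs μ : S1} {n : ℕ} (hn : 0 < n)
    (hμ : μ ∈ sampleMeanSet fun i : Fin n => θ i) :
    |(∑ i ∈ Finset.range n, unwrap (θ i - μs) ^ 2) / n - sampleVar (fun i : Fin n => θ i)|
      ≤ unwrap (μ - μs) ^ 2 := by
  have h1 : (∑ i ∈ Finset.range n, unwrap (θ i - μs) ^ 2) / n
      = frechet (fun i : Fin n => θ i) μs := by
    rw [frechet_sample_eq]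
    congr 1
    refine Finset.sum_congr rfl fun i _ => ?_
    rw [← sq_abs, abs_unwrap_sub, dist_comm]
  -- The displacement from `μ` to `μs` has zero linear term by the first-order condition, leaving
  -- only its square.
  have h2 := frechet_add_le hn (fun i : Fin n => θ i) μ (fun i => unwrap (μ - θ i))
    (fun i => coe_unwrap _) (fun i => abs_unwrap_sub _ _) (-unwrap (μ - μs))
  rw [sum_unwrap_eq_zero hn hμ, AddCircle.coe_neg, coe_unwrap, neg_sub, add_sub_cancel] at h2
  have h3 := hμ μs
  rw [h1, ← frechet_eq_sampleVar _ hμ, abs_of_nonneg (by linarith)]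
  linarith

/-! ### Asymptotic normality -/

/-- The Cramér–Wold device: the characteristic function of a vector at `t` is that of its inner
product with `t` at `1`, and Lévy's continuity theorem concludes. -/
theorem tendstoInDistribution_of_charFun_inner {Ω E : Type*} [MeasurableSpace Ω] {P : Measure Ω}
    [IsProbabilityMeasure P] [NormedAddCommGroup E] [InnerProductSpace ℝ E] [FiniteDimensional ℝ E]
    [MeasurableSpace E] [BorelSpace E] {X : ℕ → Ω → E} (hX : ∀ n, AEMeasurable (X n) P)
    {μ₀ : Measure E} [IsProbabilityMeasure μ₀]
    (h : ∀ t : E, Tendsto (fun n => charFun (P.map fun ω => inner ℝ (X n ω) t) 1) atTop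
      (𝓝 (charFun μ₀ t))) :
    TendstoInDistribution X atTop id (fun _ => P) μ₀ := by
  refine ⟨hX, aemeasurable_id, ProbabilityMeasure.tendsto_iff_tendsto_charFun.2 fun t => ?_⟩
  have h1 : ∀ n, charFun (P.map (X n)) t = charFun (P.map fun ω => inner ℝ (X n ω) t) 1 := by
    intro n
    rw [charFun_apply, charFun_apply_real, integral_map (hX n) (by fun_prop),
      integral_map ((hX n).inner_const (𝕜 := ℝ)) (by fun_prop)]
    simp
  simp only [ProbabilityMeasure.coe_mk, h1, Measure.map_id]
  exact h t

section Normality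

variable {Ω : Type*} [MeasurableSpace Ω] {P : Measure Ω} [IsProbabilityMeasure P] {γs : ℝ}
  {Y : ℕ → Ω → ℝ}

/-- The bivariate central limit theorem for `(Y, Y²)`, suitably normalized. -/
theorem tendstoInDistribution_moments (hγs : 0 < γs)
    (hlaw : ∀ i, HasLaw (Y i) (truncGauss γs) P) (hindep : iIndepFun Y P) :
    TendstoInDistribution
      (fun (n : ℕ) ω => !₂[((√(n : ℝ))⁻¹ * ∑ i ∈ Finset.range n, Y i ω) / (γs * V γs),
        ((√(n : ℝ))⁻¹ * ∑ i ∈ Finset.range n, -(Y i ω ^ 2 - V γs)) / (2 * J2 γs)])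
      atTop id (fun _ => P) (multivariateGaussian 0 (J γs)⁻¹) := by
  have hV := (V_pos hγs).ne'
  have hJ := (J2_pos γs).ne'
  have hmeas : ∀ i, AEMeasurable (Y i) P := fun i => (hlaw i).aemeasurable
  have hJinv : (J γs)⁻¹ = Matrix.diagonal ![(J1 γs)⁻¹, (J2 γs)⁻¹] := by
    refine Matrix.inv_eq_right_inv ?_
    rw [J, Matrix.diagonal_mul_diagonal, ← Matrix.diagonal_one]
    congr 1
    funext i
    fin_cases i
    · exact mul_inv_cancel₀ (J1_pos hγs).ne'
    · exact mul_inv_cancel₀ hJ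
  refine tendstoInDistribution_of_charFun_inner (fun n => ?_) fun t => ?_
  · refine (MeasurableEquiv.toLp 2 (Fin 2 → ℝ)).measurable.comp_aemeasurable ?_
    refine aemeasurable_pi_lambda _ fun a => ?_
    fin_cases a
    · simp only [Fin.zero_eta, Matrix.cons_val_zero]
      fun_prop
    · simp only [Fin.mk_one, Matrix.cons_val_one]
      fun_prop
  -- The projection on `t` is the normalized sum of `g (Y i)`. Its variance `a² V + 4 b² J2` equals
  -- `t₀² / J1 + t₁² / J2`, because `J1 = γ² V`.
  · set a := t 0 / (γs * V γs) with ha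
    set b := -(t 1 / (2 * J2 γs)) with hb
    set g : ℝ → ℝ := fun y => a * y + b * (y ^ 2 - V γs) with hg
    have hgc : Continuous g := by fun_prop
    have hE : P[fun ω => g (Y 0 ω)] = 0 :=
      ((hlaw 0).integral_comp hgc.aestronglyMeasurable).trans (integral_lin_truncGauss hγs a b)
    have hmem : MemLp (fun ω => g (Y 0 ω)) 2 P := by
      have h := memLp_of_continuous_truncGauss (γ := γs) hgc 2
      rw [← (hlaw 0).map_eq] at h
      exact h.comp_of_map (hmeas 0)
    have hVar : Var[fun ω => g (Y 0 ω); P] = t 0 ^ 2 * (J1 γs)⁻¹ + t 1 ^ 2 * (J2 γs)⁻¹ := by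
      rw [variance_of_integral_eq_zero hmem.aemeasurable hE]
      have h1 : ∫ ω, g (Y 0 ω) ^ 2 ∂P = ∫ y, g y ^ 2 ∂(truncGauss γs) :=
        (hlaw 0).integral_comp (f := fun y => g y ^ 2) (hgc.pow 2).aestronglyMeasurable
      have h2 := integral_lin_mul_lin_truncGauss hγs a b a b
      simp only [← pow_two] at h2
      rw [h1, h2, ha, hb, J1_eq hγs]
      field_simp
      ring
    have hclt := tendstoInDistribution_inv_sqrt_mul_sum_sub (P := P)
      (X := fun i ω => g (Y i ω)) (Y := id) HasLaw.id hmem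
      (hindep.comp (fun _ => g) fun _ => hgc.measurable)
      (identDistrib_comp_of_hasLaw hlaw hgc.measurable)
    have hlim := ProbabilityMeasure.tendsto_iff_tendsto_charFun.1 hclt.tendsto 1
    simp only [ProbabilityMeasure.coe_mk, Measure.map_id, hE, mul_zero, sub_zero] at hlim
    have hlimit : charFun (gaussianReal 0 Var[fun ω => g (Y 0 ω); P].toNNReal) 1
        = charFun (multivariateGaussian 0 (J γs)⁻¹) t := by
      rw [charFun_gaussianReal, charFun_multivariateGaussian (posDef_J hγs).inv.posSemidef, hJinv,
        Real.coe_toNNReal _ (variance_nonneg _ _), hVar]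
      congr 1
      simp [Matrix.mulVec_diagonal, dotProduct, Fin.sum_univ_two]
      ring
    rw [← hlimit]
    refine hlim.congr fun n => ?_
    congr 2
    funext ω
    rw [PiLp.inner_apply, Fin.sum_univ_two]
    simp only [hg, Finset.sum_add_distrib, ← Finset.mul_sum, ha, hb, Finset.sum_neg_distrib]
    simp
    ring

end Normality

section MLE

variable {Ω : Type*} [MeasurableSpace Ω] {P : Measure Ω} [IsProbabilityMeasure P]
  {μs : S1} {γs : ℝ} {θ : ℕ → Ω → S1} {μh : ℕ → Ω → S1} {γh : ℕ → Ω → ℝ}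

theorem ae_tendsto_mle (hγs : 0 < γs) (hlaw : ∀ i, HasLaw (θ i) (gN μs γs) P)
    (hindep : iIndepFun θ P)
    (hmle : ∀ n : ℕ, 2 ≤ n → ∀ᵐ ω ∂P, (μh n ω, γh n ω) ∈ mleSet fullParam (fun i : Fin n => θ i ω)) :
    ∀ᵐ ω ∂P, Tendsto (fun n => (μh n ω, γh n ω)) atTop (𝓝 (μs, γs)) := by
  have h1 : ∀ᵐ ω ∂P, ∀ n : ℕ, 2 ≤ n →
      (μh n ω, γh n ω) ∈ mleSet fullParam (fun i : Fin n => θ i ω) :=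
    ae_all_iff.2 fun n => by
      by_cases hn : 2 ≤ n
      · exact (hmle n hn).mono fun ω hω _ => hω
      · exact Eventually.of_forall fun ω h => absurd h hn
  filter_upwards [h1, ae_eventually_mleSet_subset hγs hlaw hindep] with ω hω1 hω2
  refine tendsto_def.2 fun U hU => ?_
  filter_upwards [hω2 U hU, eventually_ge_atTop 2] with n hn hn2 using hn.2 (hω1 n hn2)

theorem highProb_abs_unwrap_le (hγs : 0 < γs) (hlaw : ∀ i, HasLaw (θ i) (gN μs γs) P)
    (hindep : iIndepFun θ P) (hμh : ∀ n, AEMeasurable (μh n) P)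
    (hmle : ∀ n : ℕ, 2 ≤ n → ∀ᵐ ω ∂P, (μh n ω, γh n ω) ∈ mleSet fullParam (fun i : Fin n => θ i ω))
    {ε : ℝ} (hε : 0 < ε) : HighProb P fun n ω => |unwrap (μh n ω - μs)| ≤ ε := by
  have h := highProb_abs_sub_le_of_tendsto_ae (P := P) (f := fun n ω => dist (μh n ω) μs) (a := 0)
    (fun n => (hμh n).dist aemeasurable_const) ?_ hε
  · refine h.mono (Eventually.of_forall fun n ω hω => ?_)
    rwa [sub_zero, abs_of_nonneg dist_nonneg, ← abs_unwrap_sub] at hω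
  · filter_upwards [ae_tendsto_mle hγs hlaw hindep hmle] with ω hω
    exact tendsto_iff_dist_tendsto_zero.1 ((continuous_fst.tendsto _).comp hω)

/-- Members of the MLE set, described through the sample mean set and the sample variance. -/
theorem highProb_mem (hlaw : ∀ i, HasLaw (θ i) (gN μs γs) P) (hindep : iIndepFun θ P)
    (hmle : ∀ n : ℕ, 2 ≤ n → ∀ᵐ ω ∂P,
      (μh n ω, γh n ω) ∈ mleSet fullParam (fun i : Fin n => θ i ω)) :
    HighProb P fun n ω => μh n ω ∈ sampleMeanSet (fun i : Fin n => θ i ω) ∧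
      V (γh n ω) = sampleVar (fun i : Fin n => θ i ω) := by
  refine highProb_of_ae ?_
  filter_upwards [eventually_ge_atTop 2] with n hn
  filter_upwards [hmle n hn, ae_exists_ne hlaw hindep] with ω h1 h2
  rw [mleSet_fullParam (h2 n hn)] at h1
  refine ⟨h1.1, ?_⟩
  have h3 : γh n ω = _ := mem_singleton_iff.1 h1.2
  rw [h3, V_VInv (sampleVar_mem_image_V (h2 n hn))]

/-- The slope `1 - 2π f(π)` of the estimating equation is `γ V(γ)` by `mul_V`. The error is relative
to `|T| + 1` because boundedness in probability of `T = √n a` is a consequence of this estimate,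
through `BoundedInProb.of_linear`. -/
theorem highProb_mean_linearization (hγs : 0 < γs) (hlaw : ∀ i, HasLaw (θ i) (gN μs γs) P)
    (hindep : iIndepFun θ P) (hμh : ∀ n, AEMeasurable (μh n) P)
    (hmle : ∀ n : ℕ, 2 ≤ n → ∀ᵐ ω ∂P, (μh n ω, γh n ω) ∈ mleSet fullParam (fun i : Fin n => θ i ω))
    {ε : ℝ} (hε : 0 < ε) :
    HighProb P fun n ω => |γs * V γs * (√(n : ℝ) * unwrap (μh n ω - μs))
      - (√(n : ℝ))⁻¹ * ∑ i ∈ Finset.range n, unwrap (θ i ω - μs)|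
        ≤ ε * (|√(n : ℝ) * unwrap (μh n ω - μs)| + 1) := by
  have hY := hasLaw_unwrap_sample hlaw
  have hplus : ∀ i, HasLaw (fun ω => π + unwrap (θ i ω - μs)) ((truncGauss γs).map fun t => π + t) P :=
    fun i => HasLaw.fun_comp ⟨by fun_prop, rfl⟩ (hY i)
  have hminus : ∀ i, HasLaw (fun ω => π - unwrap (θ i ω - μs)) ((truncGauss γs).map fun t => π - t) P :=
    fun i => HasLaw.fun_comp ⟨by fun_prop, rfl⟩ (hY i)
  have hiplus : iIndepFun (fun i ω => π + unwrap (θ i ω - μs)) P :=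
    hindep.comp (fun _ x => π + unwrap (x - μs)) fun _ =>
      (measurable_unwrap.comp (by fun_prop)).const_add π
  have himinus : iIndepFun (fun i ω => π - unwrap (θ i ω - μs)) P :=
    hindep.comp (fun _ x => π - unwrap (x - μs)) fun _ =>
      (measurable_unwrap.comp (by fun_prop)).const_sub π
  have : IsProbabilityMeasure ((truncGauss γs).map fun t => π + t) :=
    Measure.isProbabilityMeasure_map (by fun_prop)
  have : IsProbabilityMeasure ((truncGauss γs).map fun t => π - t) :=
    Measure.isProbabilityMeasure_map (by fun_prop)
  -- The division compensates the factor `2π` that each wrapped observation contributes.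
  have hR : 0 < ε / (2 * π) := div_pos hε two_pi_pos
  obtain ⟨δ₁, hδ₁, h₁⟩ := exists_tendsto_meas_count hplus hiplus (edgeDensity_pos γs).le
    (fun _ h => real_Iic_map_pi_add γs h) hR
  obtain ⟨δ₂, hδ₂, h₂⟩ := exists_tendsto_meas_count hminus himinus (edgeDensity_pos γs).le
    (fun _ h => real_Iic_map_pi_sub γs h) hR
  have h₃ := highProb_abs_unwrap_le hγs hlaw hindep hμh hmle (lt_min hδ₁ hδ₂)
  have hall := ((HighProb.and (P := P) h₁ h₂).and h₃).and (highProb_mem hlaw hindep hmle)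
  refine hall.mono ?_
  filter_upwards [eventually_gt_atTop 0] with n hn ω hω
  obtain ⟨⟨⟨hω₁, hω₂⟩, hω₃⟩, hω₄, -⟩ := hω
  have hn' : (0 : ℝ) < n := by exact_mod_cast hn
  have hs : 0 < √(n : ℝ) := Real.sqrt_pos.2 hn'
  have hss : √(n : ℝ) * √n = n := Real.mul_self_sqrt hn'.le
  have key := abs_linearized_mean_le hn hω₄ hω₃
    (fun h hh => hω₁ h ⟨hh.1, hh.2.trans (min_le_left _ _)⟩)
    (fun h hh => hω₂ h ⟨hh.1, hh.2.trans (min_le_right _ _)⟩)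
  rw [← mul_V hγs] at key
  set u := unwrap (μh n ω - μs) with hu
  set S := ∑ i ∈ Finset.range n, unwrap (θ i ω - μs) with hS
  have e1 : γs * V γs * (√(n : ℝ) * u) - (√(n : ℝ))⁻¹ * S
      = (√(n : ℝ))⁻¹ * (n * (γs * V γs * u) - S) := by
    have : ∀ s m : ℝ, 0 < s → s * s = m →
        γs * V γs * (s * u) - s⁻¹ * S = s⁻¹ * (m * (γs * V γs * u) - S) := by
      rintro s _ hs rfl
      field_simp
    exact this _ _ hs hss
  rw [e1, abs_mul, abs_inv, abs_of_pos hs, inv_mul_le_iff₀ hs, abs_mul, abs_of_pos hs]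
  refine key.trans_eq ?_
  have : ∀ s m : ℝ, 0 < s → s * s = m →
      2 * π * m * (ε / (2 * π) * (|u| + s⁻¹)) = s * (ε * (s * |u| + 1)) := by
    rintro s _ hs rfl
    field_simp
  exact this _ _ hs hss

theorem exists_abs_V_sub_le (hγs : 0 < γs) {ε : ℝ} (hε : 0 < ε) :
    ∃ δ > 0, ∀ γ, |γ - γs| ≤ δ → |V γ - V γs + 2 * J2 γs * (γ - γs)| ≤ ε * |γ - γs| := by
  have h := (hasDerivAt_iff_isLittleO.1 (hasDerivAt_V hγs)).def hε
  obtain ⟨δ, hδ, h'⟩ := Metric.eventually_nhds_iff.1 h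
  refine ⟨δ / 2, by positivity, fun γ hγ => ?_⟩
  have h1 := h' (y := γ) (by rw [Real.dist_eq]; linarith)
  rw [Real.norm_eq_abs, Real.norm_eq_abs, smul_eq_mul] at h1
  convert! h1 using 2
  ring

/-- A delta method for the equation `V γ̂ = sampleVar`. Recentring the variance at `μs` costs at
most `√n a² = (√n a)² / √n`, negligible by `hbdd`. -/
theorem highProb_concentration_linearization (hγs : 0 < γs)
    (hlaw : ∀ i, HasLaw (θ i) (gN μs γs) P) (hindep : iIndepFun θ P)
    (hγh : ∀ n, AEMeasurable (γh n) P)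
    (hmle : ∀ n : ℕ, 2 ≤ n → ∀ᵐ ω ∂P, (μh n ω, γh n ω) ∈ mleSet fullParam (fun i : Fin n => θ i ω))
    (hbdd : BoundedInProb P fun n ω => √(n : ℝ) * unwrap (μh n ω - μs)) {ε : ℝ} (hε : 0 < ε) :
    HighProb P fun n ω => |2 * J2 γs * (√(n : ℝ) * (γh n ω - γs))
      - (√(n : ℝ))⁻¹ * ∑ i ∈ Finset.range n, -(unwrap (θ i ω - μs) ^ 2 - V γs)|
        ≤ ε * (|√(n : ℝ) * (γh n ω - γs)| + 1) := by
  obtain ⟨δ, hδ, hVδ⟩ := exists_abs_V_sub_le hγs hε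
  have h1 : HighProb P fun n ω => |γh n ω - γs| ≤ δ := by
    refine highProb_abs_sub_le_of_tendsto_ae hγh ?_ hδ
    filter_upwards [ae_tendsto_mle hγs hlaw hindep hmle] with ω hω
    exact (continuous_snd.tendsto _).comp hω
  have h2 : HighProb P fun n ω => (√(n : ℝ) * unwrap (μh n ω - μs)) ^ 2 / √n ≤ ε := by
    refine hbdd.highProb fun M hM => highProb_of_ae ?_
    have hlim : Tendsto (fun n : ℕ => M ^ 2 / √(n : ℝ)) atTop (𝓝 0) :=
      Tendsto.const_div_atTop (Real.tendsto_sqrt_atTop.comp tendsto_natCast_atTop_atTop) _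
    filter_upwards [hlim.eventually_le_const hε] with n hn
    refine Eventually.of_forall fun ω hω => le_trans ?_ hn
    rw [← sq_abs]
    gcongr
  refine ((h1.and h2).and (highProb_mem hlaw hindep hmle)).mono ?_
  filter_upwards [eventually_gt_atTop 0] with n hn ω hω
  obtain ⟨⟨hω₁, hω₂⟩, hω₃, hω₄⟩ := hω
  have hn' : (0 : ℝ) < n := by exact_mod_cast hn
  have hs : 0 < √(n : ℝ) := Real.sqrt_pos.2 hn'
  have hss : √(n : ℝ) * √n = n := Real.mul_self_sqrt hn'.le
  have h3 := hVδ _ hω₁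
  have h4 := abs_sum_sq_sub_sampleVar_le hn hω₃ (μs := μs) (θ := fun i => θ i ω)
  rw [← hω₄] at h4
  set u := unwrap (μh n ω - μs) with hu
  set g := γh n ω with hg
  set Q := ∑ i ∈ Finset.range n, unwrap (θ i ω - μs) ^ 2 with hQ
  have e1 : 2 * J2 γs * (√(n : ℝ) * (g - γs))
      - (√(n : ℝ))⁻¹ * ∑ i ∈ Finset.range n, -(unwrap (θ i ω - μs) ^ 2 - V γs)
      -- The first summand is the Taylor remainder of `V` at `γs`; the second is the recentring
      -- error.
      = √(n : ℝ) * (V g - V γs + 2 * J2 γs * (g - γs)) + √(n : ℝ) * (Q / n - V g) := by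
    rw [Finset.sum_neg_distrib, Finset.sum_sub_distrib, Finset.sum_const, Finset.card_range,
      nsmul_eq_mul, ← hQ]
    have : ∀ s m : ℝ, 0 < s → s * s = m → 2 * J2 γs * (s * (g - γs)) - s⁻¹ * -(Q - m * V γs)
        = s * (V g - V γs + 2 * J2 γs * (g - γs)) + s * (Q / m - V g) := by
      rintro s _ hs rfl
      field_simp
      ring
    exact this _ _ hs hss
  have e2 : (√(n : ℝ) * u) ^ 2 / √n = √n * u ^ 2 := by
    field_simp
  rw [e2] at hω₂
  rw [e1]
  calc |√(n : ℝ) * (V g - V γs + 2 * J2 γs * (g - γs)) + √(n : ℝ) * (Q / n - V g)|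
      ≤ √(n : ℝ) * (ε * |g - γs|) + √n * u ^ 2 := by
        refine (abs_add_le _ _).trans ?_
        rw [abs_mul, abs_mul, abs_of_pos hs]
        gcongr
    _ ≤ ε * (|√(n : ℝ) * (g - γs)| + 1) := by
        rw [abs_mul, abs_of_pos hs]
        linarith

theorem norm_euclidean_pair_le (a b : ℝ) : ‖!₂[a, b]‖ ≤ |a| + |b| := by
  rw [EuclideanSpace.norm_eq, Fin.sum_univ_two]
  refine Real.sqrt_le_iff.2 ⟨by positivity, ?_⟩
  simp only [Real.norm_eq_abs, Matrix.cons_val_zero, Matrix.cons_val_one]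
  nlinarith [abs_nonneg a, abs_nonneg b]

theorem tendstoInDistribution_mle (hγs : 0 < γs) (hlaw : ∀ i, HasLaw (θ i) (gN μs γs) P)
    (hindep : iIndepFun θ P) (hμh : ∀ n, AEMeasurable (μh n) P) (hγh : ∀ n, AEMeasurable (γh n) P)
    (hmle : ∀ n : ℕ, 2 ≤ n → ∀ᵐ ω ∂P,
      (μh n ω, γh n ω) ∈ mleSet fullParam (fun i : Fin n => θ i ω)) :
    TendstoInDistribution
      (fun (n : ℕ) ω => !₂[√(n : ℝ) * unwrap (μh n ω - μs), √(n : ℝ) * (γh n ω - γs)])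
      atTop id (fun _ => P) (multivariateGaussian 0 (J γs)⁻¹) := by
  have hY := hasLaw_unwrap_sample hlaw
  have hYi : iIndepFun (fun i ω => unwrap (θ i ω - μs)) P :=
    hindep.comp (fun _ x => unwrap (x - μs)) fun _ => measurable_unwrap.comp (by fun_prop)
  have hc₁ : 0 < γs * V γs := mul_pos hγs (V_pos hγs)
  have hc₂ : 0 < 2 * J2 γs := mul_pos two_pos (J2_pos γs)
  have hS₁ := boundedInProb_sum hY hYi (g := fun y => y) measurable_id
    (memLp_of_continuous_truncGauss continuous_id 2)
    (by simpa using integral_lin_truncGauss hγs 1 0)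
  have hS₂ := boundedInProb_sum hY hYi (g := fun y => -(y ^ 2 - V γs)) (by fun_prop)
    (memLp_of_continuous_truncGauss (by fun_prop) 2)
    (by simpa using integral_lin_truncGauss hγs 0 (-1))
  have hT₁ := fun ε (hε : (0 : ℝ) < ε) => highProb_mean_linearization hγs hlaw hindep hμh hmle hε
  have hT₂ := fun ε (hε : (0 : ℝ) < ε) => highProb_concentration_linearization hγs hlaw hindep hγh
    hmle (hS₁.of_linear hc₁ hT₁) hε
  refine tendstoInDistribution_of_tendstoInMeasure_sub _ _
    (tendstoInDistribution_moments hγs hY hYi) ?_ fun n => ?_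
  · refine tendstoInMeasure_iff_norm.2 fun ε hε => ?_
    -- Slutsky's argument: coordinate errors of `ε / 3` keep the norm of the difference below `ε`.
    have h := (highProb_abs_sub_div_le hS₁ hc₁ hT₁ (show 0 < ε / 3 by positivity)).and
      (highProb_abs_sub_div_le hS₂ hc₂ hT₂ (show 0 < ε / 3 by positivity))
    refine tendsto_of_tendsto_of_tendsto_of_le_of_le tendsto_const_nhds h (fun _ => zero_le)
      fun n => measure_mono fun ω hω hcon => ?_
    have h1 : ε ≤ ‖!₂[√(n : ℝ) * unwrap (μh n ω - μs)
        - ((√(n : ℝ))⁻¹ * ∑ i ∈ Finset.range n, unwrap (θ i ω - μs)) / (γs * V γs),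
        √(n : ℝ) * (γh n ω - γs) - ((√(n : ℝ))⁻¹ * ∑ i ∈ Finset.range n,
          -(unwrap (θ i ω - μs) ^ 2 - V γs)) / (2 * J2 γs)]‖ := by
      refine hω.trans_eq ?_
      congr 1
      ext a
      fin_cases a <;> simp
    have h2 := h1.trans (norm_euclidean_pair_le _ _)
    linarith [hcon.1, hcon.2]
  · refine (MeasurableEquiv.toLp 2 (Fin 2 → ℝ)).measurable.comp_aemeasurable ?_
    refine aemeasurable_pi_lambda _ fun a => ?_
    fin_cases a
    · exact (measurable_unwrap.comp_aemeasurable ((hμh n).sub_const μs)).const_mul _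
    · exact ((hγh n).sub_const γs).const_mul _

end MLE

end GeodesicNormal

end

theorem mainTheorem1 {Ω : Type*} [MeasurableSpace Ω] (P : Measure Ω) [IsProbabilityMeasure P]
    (μs : S1) (γs : ℝ) (hγs : 0 < γs)
    (θ : ℕ → Ω → S1) (hlaw : ∀ i, HasLaw (θ i) (gN μs γs) P) (hindep : iIndepFun θ P) :
    -- (i) for every non-constant sample the MLE set is (sample mean set) × {V⁻¹(sample variance)};
    -- for `n ≥ 2` this applies almost surely, also with the antipode of `μs` left out
    (StrictAntiOn V (Ioi 0) ∧
      (∀ (n : ℕ) (x : Fin n → S1), (∃ i j, x i ≠ x j) →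
        (sampleMeanSet x).Nonempty ∧ sampleVar x ∈ V '' Ioi 0 ∧
          mleSet fullParam x = sampleMeanSet x ×ˢ {VInv (sampleVar x)}) ∧
      (∀ᵐ ω ∂P, ∀ n : ℕ, 2 ≤ n →
        (∃ i j : Fin n, θ i ω ≠ θ j ω) ∧
          mleSet (cutParam μs) (fun i : Fin n => θ i ω) =
            mleSet fullParam (fun i : Fin n => θ i ω))) ∧
    -- (ii) strong consistency of the MLE set
    (∀ᵐ ω ∂P, ∀ U ∈ 𝓝 (μs, γs), ∀ᶠ n : ℕ in atTop,
      (mleSet fullParam (fun i : Fin n => θ i ω)).Nonempty ∧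
        mleSet fullParam (fun i : Fin n => θ i ω) ⊆ U) ∧
    -- (iii) asymptotic normality of every measurable choice of MLE
    (fisherInfo μs γs = J γs ∧ (J γs).PosDef ∧
      ∀ (μh : ℕ → Ω → S1) (γh : ℕ → Ω → ℝ),
        (∀ n, AEMeasurable (μh n) P) → (∀ n, AEMeasurable (γh n) P) →
        (∀ n : ℕ, 2 ≤ n → ∀ᵐ ω ∂P,
          (μh n ω, γh n ω) ∈ mleSet fullParam (fun i : Fin n => θ i ω)) →
        TendstoInDistribution
          (fun (n : ℕ) ω => !₂[√(n : ℝ) * unwrap (μh n ω - μs), √(n : ℝ) * (γh n ω - γs)])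
          atTop id (fun _ => P) (multivariateGaussian 0 (J γs)⁻¹)) := by
  refine ⟨⟨strictAntiOn_V, fun n x hx => ⟨sampleMeanSet_nonempty x, sampleVar_mem_image_V hx,
    mleSet_fullParam hx⟩, ?_⟩, ae_eventually_mleSet_subset hγs hlaw hindep,
    fisherInfo_eq μs hγs, posDef_J hγs, fun μh γh hμh hγh hmle =>
      tendstoInDistribution_mle hγs hlaw hindep hμh hγh hmle⟩
  filter_upwards [ae_exists_ne hlaw hindep, ae_notMem_sampleMeanSet hlaw hindep (μs + ((π : ℝ) : S1))]
    with ω h1 h2 n hn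
  exact ⟨h1 n hn, mleSet_cutParam (h1 n hn) (h2 n (by omega))⟩
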